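/- Let $\mathcal E$ be a symmetric monoidal category with finite colimits that is additive (preadditive and linear, with bilinear tensor product) over a field of characteristic zero. An $\mathbb S$-module is a sequence of representations $A(n)$ of $\mathbb S_n$ in $\mathcal E$, $n\ge 1$. For a finite group $G$, a $(G\times\mathbb S)$-module is a sequence of representations of $G\times\mathbb S_n$ ($n\ge1$), and a $(G\wr\mathbb S)$-module is a sequence of representations of $G\wr\mathbb S_n=G^n\rtimes\mathbb S_n$. If $W$ is a $(G\wr\mathbb S)$-module and $A$ a $(G\times\mathbb S)$-module, then $W\circ_G A$ is the $\mathbb S$-module $$(W\circ_G A)(n)=\bigoplus_{k\ge 0} W(k)\otimes_{G\wr\mathbb S_k}(A^{\otimes k})(n),\qquad (A^{\otimes k})(n)=\bigoplus_{f}\ \bigotimes_{i=1}^k A(f^{-1}(i)),$$ where $f$ runs through the surjections $\{1,\dots,n\}\to\{1,\dots,k\}$. Let $D_n\subset\mathbb S_2\wr\mathbb S_n$ be the subgroup generated by $(\mathbf 1,\tau)$ and $(-\mathbf 1,\sigma)$, where $\tau=(1\,2\cdots n)$, $\sigma(i)=n+1-i$, $\mathbf 1=(1,\dots,1)$ and $-\mathbf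 1=(-1,\dots,-1)$ (so reflections also swap the two marked legs at each vertex), and let $\mathsf{Dih}(n)=\mathrm{Ind}_{D_n}^{\mathbb S_2\wr\mathbb S_n}\mathbf 1$. Let $\mathcal V$ be a stable $\mathbb S$-module in $\mathcal E$, i.e. a family of representations $\mathcal V((g,n))$ of $\mathbb S_n$ ($g,n\ge0$) that vanish if $2g-2+n\le 0$. Let $\mathbf a_0^{(2)}$ be the $(\mathbb S_2\times\mathbb S)$-module $n\mapsto \mathrm{Res}^{\mathbb S_{n+2}}_{\mathbb S_2\times\mathbb S_n}\mathcal V((0,n+2))$, and let $\mathbf b_1$ be the $\mathbb S$-module $n\mapsto\mathbb M\mathcal V((1,n))$, where $\mathbb M\mathcal V((g,n))$ is the colimit of $\mathcal V((\Gamma))=\bigotimes_v\mathcal V((g(v),\mathrm{Flags}(v)))$ over the groupoid of stable graphs $\Gamma$ of genus $g$ with legs labelled by $1,\dots,n$. A necklace is a connected graph with first Betti number $1$ that is not disconnected by removing any edge. Let $\mathbf n(n)$ be the colimit of $\mathcal V((\Gamma))$ over the subgroupoid of those stable graphs of genus one with $n$ labelled legs that are necklaces and all of whose vertices have genus zero.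 Then the canonical map $\mathbf n(n)\to\mathbf b_1(n)$ is a split monomorphism of $\mathbb S_n$-representations for each $n\ge1$, and there is an isomorphism of $\mathbb S$-modules $$\mathsf{Dih}\circ_{\mathbb S_2}\mathbf a_0^{(2)}\ \cong\ \mathbf n .$$ That is, $\mathsf{Dih}\circ_{\mathbb S_2}\mathbf a_0^{(2)}$ is the submodule of $\mathbf b_1$ of unordered necklaces of genus-zero vertices. The isomorphism can be chosen to be given by gluing: every surjection $f:\{1,\dots,n\}\to\{1,\dots,k\}$ admits a necklace $\Gamma$ obtained from $k$ genus-zero vertices, the $i$-th with two marked flags and with legs $f^{-1}(i)$, by joining the second marked flag of each vertex $i$ to the first marked flag of the next vertex in cyclic order; and for every such $\Gamma$, the composite of the isomorphism with the map $\bigotimes_i\mathbf a_0^{(2)}(f^{-1}(i))\to(\mathsf{Dih}\circ_{\mathbb S_2}\mathbf a_0^{(2)})(n)$ given by the trivial coset in $\mathsf{Dih}(k)$ is the canonical map $\bigotimes_i\mathbf a_0^{(2)}(f^{-1}(i))\cong\mathcal V((\Gamma))\to\mathbf n(n)$. -/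

import Mathlib

open CategoryTheory CategoryTheory.Limits MonoidalCategory
universe w v u
namespace Necklace
section Tensor
variable {E : Type u} [Category.{v} E] [MonoidalCategory E]

/-- The tensor product, bracketed to the right, of the objects `X i`, `i` running through a list. -/
def tensorList {ι : Type} (X : ι → E) : List ι → E
  | [] => 𝟙_ E
  | i :: L => X i ⊗ tensorList X L

/-- `Ins a L L'`: ways of obtaining the list `L'` from `L` by inserting one entry `a`. -/
inductive Ins {ι : Type} (a : ι) : List ι → List ι → Type
  | here (L : List ι) : Ins a L (a :: L)
  | there (b : ι) {L L' : List ι} (i : Ins a L L') : Ins a (b :: L) (b :: L')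

/-- `Shuffle e L L'`: ways of matching the entries of `L` with those of `L'` along `e`, one by one. -/
inductive Shuffle {ι κ : Type} (e : ι → κ) : List ι → List κ → Type
  | nil : Shuffle e [] []
  | cons {a : ι} {L : List ι} {L' L'' : List κ} (i : Ins (e a) L' L'') (s : Shuffle e L L') :
      Shuffle e (a :: L) L''

theorem Ins.perm {ι : Type} {a : ι} {L L' : List ι} (i : Ins a L L') : L'.Perm (a :: L) := by
  induction i with
  | here L => exact List.Perm.refl _
  | there b i ih => exact (ih.cons b).trans (List.Perm.swap _ _ _)

theorem Ins.nonempty {ι : Type} {a : ι} {L : List ι} (h : a ∈ L) : ∃ L', Nonempty (Ins a L' L) := by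
  induction L with
  | nil => simp at h
  | cons b L ih =>
    by_cases hb : a = b
    · subst hb; exact ⟨L, ⟨.here L⟩⟩
    · obtain ⟨L', ⟨i⟩⟩ := ih (by simpa [hb] using h)
      exact ⟨b :: L', ⟨.there b i⟩⟩

theorem Shuffle.nonempty {ι κ : Type} (e : ι → κ) {L : List ι} {L' : List κ}
    (h : (L.map e).Perm L') : Nonempty (Shuffle e L L') := by
  induction L generalizing L' with
  | nil =>
    obtain rfl : L' = [] := by simpa using h.symm
    exact ⟨.nil⟩
  | cons a L ih =>
    obtain ⟨M, ⟨i⟩⟩ := Ins.nonempty (h.mem_iff.1 (by simp) : e a ∈ L')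
    obtain ⟨s⟩ := ih ((h.trans i.perm).cons_inv : (L.map e).Perm M)
    exact ⟨.cons i s⟩

theorem Ins.unique {ι : Type} {a : ι} {M M' L : List ι} (hL : L.Nodup) (i : Ins a M L)
    (j : Ins a M' L) : (⟨M, i⟩ : Σ M, Ins a M L) = ⟨M', j⟩ := by
  induction i generalizing M' with
  | here L =>
    cases j with
    | here => rfl
    | there b j => exact absurd (j.perm.mem_iff.2 (by simp)) (List.nodup_cons.1 hL).1
  | there b i ih =>
    cases j with
    | here => exact absurd (i.perm.mem_iff.2 (by simp)) (List.nodup_cons.1 hL).1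
    | there b j =>
      have := ih (List.nodup_cons.1 hL).2 j
      cases this
      rfl

theorem Shuffle.unique {ι κ : Type} {e : ι → κ} {L : List ι} {L' : List κ} (hL : L'.Nodup)
    (s t : Shuffle e L L') : s = t := by
  induction s with
  | nil => cases t; rfl
  | cons i s ih =>
    cases t with
    | cons j t =>
      cases Ins.unique hL i j
      rw [ih (List.nodup_cons.1 (i.perm.nodup_iff.1 hL)).2 t]

variable [SymmetricCategory E]

/-- The swap `A ⊗ (B ⊗ C) ⟶ B ⊗ (A ⊗ C)` of the first two factors. -/
def swapFirst (A B C : E) : A ⊗ (B ⊗ C) ⟶ B ⊗ (A ⊗ C) :=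
  (α_ A B C).inv ≫ (β_ A B).hom ▷ C ≫ (α_ B A C).hom

theorem swapFirst_swapFirst (A B C : E) : swapFirst A B C ≫ swapFirst B A C = 𝟙 _ := by
  simp [swapFirst, ← comp_whiskerRight_assoc]

theorem swapFirst_naturality {A A' B B' C C' : E} (f : A ⟶ A') (g : B ⟶ B') (h : C ⟶ C') :
    (f ⊗ₘ (g ⊗ₘ h)) ≫ swapFirst A' B' C' = swapFirst A B C ≫ (g ⊗ₘ (f ⊗ₘ h)) := by
  simp only [swapFirst, Category.assoc]
  rw [associator_inv_naturality_assoc, ← tensorHom_id, tensorHom_comp_tensorHom_assoc,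
    BraidedCategory.braiding_naturality, Category.comp_id, ← associator_naturality,
    ← tensorHom_id, tensorHom_comp_tensorHom_assoc, Category.id_comp]

theorem swapFirst_whisker (A B : E) {C C' : E} (h : C ⟶ C') :
    A ◁ B ◁ h ≫ swapFirst A B C' = swapFirst A B C ≫ B ◁ A ◁ h := by
  simpa using swapFirst_naturality (𝟙 A) (𝟙 B) h

theorem swapFirst_yang_baxter (A B C T : E) :
    A ◁ swapFirst B C T ≫ swapFirst A C (B ⊗ T) ≫ C ◁ swapFirst A B T =
      swapFirst A B (C ⊗ T) ≫ B ◁ swapFirst A C T ≫ swapFirst B C (A ⊗ T) := by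
  have h := BraidedCategory.yang_baxter' A B C
  simp only [swapFirst]
  calc
    _ = 𝟙 _ ⊗≫ (𝟙 ((A ⊗ B) ⊗ C) ⊗≫ (A ◁ (β_ B C).hom ⊗≫ (β_ A C).hom ▷ B ⊗≫
          C ◁ (β_ A B).hom) ⊗≫ 𝟙 ((C ⊗ B) ⊗ A)) ▷ T ⊗≫ 𝟙 (C ⊗ B ⊗ A ⊗ T) := by monoidal
    _ = 𝟙 _ ⊗≫ ((β_ A B).hom ▷ C ⊗≫ B ◁ (β_ A C).hom ⊗≫ (β_ B C).hom ▷ A) ▷ T ⊗≫ 𝟙 _ := by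
          rw [← h]
    _ = _ := by monoidal

/-- Moving a first tensor factor to the place prescribed by an insertion, by the symmetry of `E`. -/
def Ins.map {ι : Type} (X : ι → E) {a : ι} : {L L' : List ι} → Ins a L L' →
    (X a ⊗ tensorList X L ⟶ tensorList X L')
  | _, _, .here _ => 𝟙 _
  | _, _, .there b i => swapFirst (X a) (X b) _ ≫ X b ◁ i.map X

/-- The map of tensor products that applies `f` to the factors and permutes them by the symmetry. -/
def Shuffle.map {ι κ : Type} {e : ι → κ} {X : ι → E} {Y : κ → E} (f : ∀ i, X i ⟶ Y (e i)) :
    {L : List ι} → {L' : List κ} → Shuffle e L L' → (tensorList X L ⟶ tensorList Y L')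
  | _, _, .nil => 𝟙 _
  | _, _, .cons (a := a) i s => (f a ⊗ₘ s.map f) ≫ i.map Y

theorem Ins.exchange {ι : Type} (X : ι → E) {a b : ι} {L L' L'' : List ι} (i : Ins a L L')
    (j : Ins b L' L'') : ∃ (M : List ι) (j' : Ins b L M) (i' : Ins a M L''),
      X b ◁ i.map X ≫ j.map X = swapFirst (X b) (X a) _ ≫ X a ◁ j'.map X ≫ i'.map X := by
  induction j generalizing L with
  | here L' =>
    refine ⟨_, .here L, .there b i, ?_⟩
    have := swapFirst_swapFirst (X b) (X a) (tensorList X L)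
    simp [Ins.map, tensorList, reassoc_of% this]
  | there c j ih =>
    cases i with
    | here => exact ⟨_, j, .here _, by simp [Ins.map, tensorList]⟩
    | there c i =>
      obtain ⟨M, j', i', h⟩ := ih i
      refine ⟨_, .there c j', .there c i', ?_⟩
      simp only [Ins.map, tensorList, whiskerLeft_comp, Category.assoc]
      have h1 := swapFirst_whisker (X b) (X c) (i.map X)
      have h2 := swapFirst_whisker (X a) (X c) (j'.map X)
      have h3 := swapFirst_yang_baxter (X b) (X a) (X c)
      rw [reassoc_of% h1, ← whiskerLeft_comp, h, reassoc_of% h2]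
      simp only [whiskerLeft_comp]
      rw [reassoc_of% h3]

theorem Shuffle.ins {ι κ : Type} {e : ι → κ} {X : ι → E} {Y : κ → E} (f : ∀ i, X i ⟶ Y (e i))
    {a : ι} {L L' : List ι} {L'' : List κ} (i : Ins a L L') (t : Shuffle e L' L'') :
    ∃ (M : List κ) (t' : Shuffle e L M) (i' : Ins (e a) M L''),
      i.map X ≫ t.map f = (f a ⊗ₘ t'.map f) ≫ i'.map Y := by
  induction i generalizing L'' with
  | here L =>
    cases t with
    | cons i t => exact ⟨_, t, i, Category.id_comp _⟩
  | there b i ih =>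
    cases t with
    | cons j t =>
      obtain ⟨M, t', i', h⟩ := ih t
      obtain ⟨N, j', k, h'⟩ := i'.exchange Y j
      refine ⟨N, .cons j' t', k, ?_⟩
      simp only [Ins.map, Shuffle.map, tensorList, Category.assoc]
      rw [← id_tensorHom, tensorHom_comp_tensorHom_assoc, h, Category.id_comp]
      have h1 : (f b ⊗ₘ ((f a ⊗ₘ t'.map f) ≫ i'.map Y)) =
        (f b ⊗ₘ (f a ⊗ₘ t'.map f)) ≫ _ ◁ i'.map Y := by
        rw [← id_tensorHom, tensorHom_comp_tensorHom, Category.comp_id]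
      have h2 := swapFirst_naturality (f b) (f a) (t'.map f)
      have h3 := swapFirst_swapFirst (X a) (X b)
      rw [h1, Category.assoc, h', reassoc_of% h2, reassoc_of% h3, ← id_tensorHom,
        tensorHom_comp_tensorHom_assoc, Category.comp_id]

theorem Shuffle.comp {ι κ μ : Type} {e : ι → κ} {e' : κ → μ} {X : ι → E} {Y : κ → E} {Z : μ → E}
    (f : ∀ i, X i ⟶ Y (e i)) (g : ∀ i, Y i ⟶ Z (e' i)) {L : List ι} {L' : List κ} {L'' : List μ}
    (s : Shuffle e L L') (t : Shuffle e' L' L'') :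
    ∃ u : Shuffle (fun i => e' (e i)) L L'',
      u.map (Y := Z) (fun i => f i ≫ g (e i)) = s.map f ≫ t.map g := by
  induction s generalizing L'' with
  | nil => cases t; exact ⟨.nil, (Category.id_comp _).symm⟩
  | cons i s ih =>
    obtain ⟨M, t', i', h⟩ := Shuffle.ins g i t
    obtain ⟨u, hu⟩ := ih t'
    refine ⟨.cons i' u, ?_⟩
    have h1 : Shuffle.map f (.cons i s) ≫ t.map g = (f _ ⊗ₘ s.map f) ≫ i.map Y ≫ t.map g :=
      Category.assoc _ _ _
    rw [h1, h, tensorHom_comp_tensorHom_assoc, ← hu]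
    rfl

theorem Shuffle.id {ι : Type} (X : ι → E) (L : List ι) :
    ∃ u : Shuffle (fun i => i) L L, u.map (Y := X) (fun i => 𝟙 (X i)) = 𝟙 _ := by
  induction L with
  | nil => exact ⟨.nil, rfl⟩
  | cons a L ih =>
    obtain ⟨u, hu⟩ := ih
    exact ⟨.cons (.here L) u, by simp [Shuffle.map, Ins.map, hu, tensorList]⟩

/-- The ordered tensor product `X 0 ⊗ (X 1 ⊗ ⋯)` of a family indexed by `Fin k`. -/
def tensorFin {k : ℕ} (X : Fin k → E) : E := tensorList X (List.finRange k)

theorem nonempty_shuffle {k l : ℕ} (e : Fin k ≃ Fin l) :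
    Nonempty (Shuffle e (List.finRange k) (List.finRange l)) :=
  Shuffle.nonempty _ ((List.perm_ext_iff_of_nodup
    ((List.nodup_finRange k).map e.injective) (List.nodup_finRange l)).2
      fun i => by simpa using ⟨e.symm i, by simp⟩)

/-- The functoriality of the ordered tensor product in a symmetric monoidal category: it applies
`f i : X i ⟶ Y (e i)` to the factors and permutes them along the bijection `e`.
(The list of all elements of `Fin l` has no repetitions, so there is only one shuffle.) -/
noncomputable def tensorMap {k l : ℕ} (e : Fin k ≃ Fin l) {X : Fin k → E} {Y : Fin l → E}
    (f : ∀ i, X i ⟶ Y (e i)) : tensorFin X ⟶ tensorFin Y :=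
  (nonempty_shuffle e).some.map f

theorem tensorMap_id {k : ℕ} (X : Fin k → E) :
    tensorMap (Equiv.refl _) (fun i => 𝟙 (X i)) = 𝟙 (tensorFin X) := by
  obtain ⟨u, hu⟩ := Shuffle.id X (List.finRange k)
  have : (nonempty_shuffle (Equiv.refl (Fin k))).some = u :=
    Shuffle.unique (List.nodup_finRange k) _ _
  exact (congrArg (Shuffle.map _) this).trans hu

theorem tensorMap_comp {k l m : ℕ} (e : Fin k ≃ Fin l) (e' : Fin l ≃ Fin m) {X : Fin k → E}
    {Y : Fin l → E} {Z : Fin m → E} (f : ∀ i, X i ⟶ Y (e i)) (g : ∀ i, Y i ⟶ Z (e' i)) :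
    tensorMap (e.trans e') (Y := Z) (fun i => f i ≫ g (e i)) = tensorMap e f ≫ tensorMap e' g := by
  obtain ⟨u, hu⟩ := Shuffle.comp f g (nonempty_shuffle e).some (nonempty_shuffle e').some
  have : (nonempty_shuffle (e.trans e')).some = u :=
    Shuffle.unique (List.nodup_finRange m) _ _
  exact (congrArg (Shuffle.map _) this).trans hu

end Tensor
/-! ### `𝕊`-modules and their variants -/

section Modules
variable (E : Type u) [Category.{v} E]

/-- An `𝕊`-module: a representation of `𝕊ₙ` in `E` for each positive integer `n`. -/
abbrev SModule := (n : ℕ+) → Action E (Equiv.Perm (Fin n))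

/-- A `(G × 𝕊)`-module: a representation of `G × 𝕊ₙ` in `E` for each positive integer `n`. -/
abbrev GSModule (G : Type) [Group G] := (n : ℕ+) → Action E (G × Equiv.Perm (Fin n))

/-- The wreath product `G ≀ 𝕊ₙ = Gⁿ ⋊ 𝕊ₙ`, with `(σ • g) i = g (σ⁻¹ i)`. -/
abbrev Wreath (G : Type) [Group G] (n : ℕ) :=
  (Fin n → G) ⋊[(mulAutArrow : Equiv.Perm (Fin n) →* MulAut (Fin n → G))] Equiv.Perm (Fin n)

instance (G : Type) [Group G] [Finite G] (n : ℕ) : Finite (Wreath G n) :=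
  Finite.of_equiv _ SemidirectProduct.equivProd.symm

/-- A `(G ≀ 𝕊)`-module: a sequence of representations of `G ≀ 𝕊ₙ` in `E`. -/
abbrev WreathModule (G : Type) [Group G] := (n : ℕ) → Action E (Wreath G n)

variable {E}

/-- The restriction `A⁽ᵐ⁾` of an `𝕊`-module to an `(𝕊ₘ × 𝕊)`-module:
`A⁽ᵐ⁾(n)` is `A(m + n)` restricted to `𝕊ₘ × 𝕊ₙ`. -/
def SModule.restrict (A : SModule E) (m : ℕ) : GSModule E (Equiv.Perm (Fin m)) := fun n =>
  (Action.res E ((finSumFinEquiv (m := m) (n := n)).permCongrHom.toMonoidHom.comp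
    (Equiv.Perm.sumCongrHom (Fin m) (Fin n)))).obj (A ⟨m + n, by positivity⟩)

namespace GSModule
variable {G : Type} [Group G] (A : GSModule E G)

/-- The action of `g : G` and of a bijection `Fin m ≃ Fin n` (which forces `m = n`). -/
def reindex {m n : ℕ+} (g : G) (e : Fin m ≃ Fin n) : (A m).V ⟶ (A n).V :=
  have h : m = n := PNat.eq (Fin.equiv_iff_eq.1 ⟨e⟩)
  eqToHom (by rw [h]) ≫ (A n).ρ (g, (finCongr (congrArg PNat.val h)).symm.trans e)

theorem reindex_self {n : ℕ+} (g : G) (e : Fin n ≃ Fin n) : A.reindex g e = (A n).ρ (g, e) := by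
  simp [reindex]

theorem reindex_comp {l m n : ℕ+} (g h : G) (e : Fin l ≃ Fin m) (e' : Fin m ≃ Fin n) :
    A.reindex (h * g) (e.trans e') = A.reindex g e ≫ A.reindex h e' := by
  obtain rfl : l = m := PNat.eq (Fin.equiv_iff_eq.1 ⟨e⟩)
  obtain rfl : l = n := PNat.eq (Fin.equiv_iff_eq.1 ⟨e'⟩)
  rw [reindex_self, reindex_self, reindex_self]
  exact (A l).ρ.map_mul (h, e') (g, e)

/-- The cardinality of a nonempty finite set. -/
noncomputable def card (I : Type) [Finite I] [Nonempty I] : ℕ+ := ⟨Nat.card I, Nat.card_pos⟩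

/-- A chosen enumeration of a nonempty finite set. -/
noncomputable def enum (I : Type) [Finite I] [Nonempty I] : I ≃ Fin (card I) := Finite.equivFin I

/-- The value `A(I)` of a `(G × 𝕊)`-module on a nonempty finite set `I`:
the object `A(n)`, `n = |I|`, where `Fin n` is identified with `I` by a chosen enumeration. -/
noncomputable def extObj (I : Type) [Finite I] [Nonempty I] : E := (A (card I)).V

/-- The action of `g : G` and of a bijection `I ≃ J` on the values at nonempty finite sets. -/
noncomputable def extMap {I J : Type} [Finite I] [Nonempty I] [Finite J] [Nonempty J]
    (g : G) (e : I ≃ J) : A.extObj I ⟶ A.extObj J :=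
  A.reindex g (((enum I).symm.trans e).trans (enum J))

theorem extMap_refl (I : Type) [Finite I] [Nonempty I] :
    A.extMap 1 (Equiv.refl I) = 𝟙 (A.extObj I) := by
  have : ((enum I).symm.trans (Equiv.refl I)).trans (enum I) = Equiv.refl _ := by ext; simp
  rw [extMap, this]
  exact (A.reindex_self (n := card I) 1 _).trans ((A (card I)).ρ.map_one)

theorem extMap_comp {I J K : Type} [Finite I] [Nonempty I] [Finite J] [Nonempty J] [Finite K]
    [Nonempty K] (g h : G) (e : I ≃ J) (e' : J ≃ K) :
    A.extMap (h * g) (e.trans e') = A.extMap g e ≫ A.extMap h e' := by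
  rw [extMap, extMap, extMap]
  refine Eq.trans ?_ (A.reindex_comp g h (((enum I).symm.trans e).trans (enum J))
    (((enum J).symm.trans e').trans (enum K)))
  refine congrArg (A.reindex (h * g)) ?_
  ext; simp

end GSModule

/-- The fibre of `f` over `i`. -/
abbrev Block {n k : ℕ} (f : Fin n → Fin k) (i : Fin k) : Type := {a : Fin n // f a = i}

/-- Surjections `Fin n → Fin k`, that is, ordered decompositions of an `n`-element set into `k`
nonempty blocks. -/
abbrev Surj (n k : ℕ) : Type := {f : Fin n → Fin k // Function.Surjective f}

instance {n k : ℕ} (f : Surj n k) (i : Fin k) : Nonempty (Block f.1 i) :=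
  let ⟨a, ha⟩ := f.2 i; ⟨⟨a, ha⟩⟩

/-- Permutations of the blocks and of the elements act on ordered decompositions. -/
def Surj.act {n k : ℕ} (σ : Equiv.Perm (Fin k)) (τ : Equiv.Perm (Fin n)) (f : Surj n k) :
    Surj n k :=
  ⟨fun a => σ (f.1 (τ.symm a)), σ.surjective.comp (f.2.comp τ.symm.surjective)⟩

/-- The bijection `a ↦ τ a` from the block of `f` at `i` to the block of `σ ∘ f ∘ τ⁻¹` at `σ i`. -/
def Surj.blockEquiv {n k : ℕ} (σ : Equiv.Perm (Fin k)) (τ : Equiv.Perm (Fin n)) (f : Surj n k)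
    (i : Fin k) : Block f.1 i ≃ Block (f.act σ τ).1 (σ i) :=
  τ.subtypeEquiv fun a => by simp [Surj.act]

variable [MonoidalCategory E] [SymmetricCategory E]

/-- The summand `A(f⁻¹(1)) ⊗ ⋯ ⊗ A(f⁻¹(k))` of the `k`-fold tensor power. -/
noncomputable def GSModule.blockTensor {G : Type} [Group G] (A : GSModule E G) {n k : ℕ}
    (f : Surj n k) : E :=
  tensorFin fun i => A.extObj (Block f.1 i)

/-- The map from the summand at `f` to the summand at `σ ∘ f ∘ τ⁻¹` that is induced by
`((g, σ), τ)`. -/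
noncomputable def GSModule.blockMap {G : Type} [Group G] (A : GSModule E G) {n k : ℕ}
    (x : Wreath G k × Equiv.Perm (Fin n)) (f : Surj n k) :
    A.blockTensor f ⟶ A.blockTensor (f.act x.1.right x.2) :=
  tensorMap x.1.right fun i => A.extMap (x.1.left (x.1.right i)) (f.blockEquiv x.1.right x.2 i)

theorem GSModule.blockMap_one {G : Type} [Group G] (A : GSModule E G) {n k : ℕ} (f : Surj n k) :
    A.blockMap 1 f = 𝟙 (A.blockTensor f) := by
  refine Eq.trans ?_ (tensorMap_id _)
  have h : ∀ i : Fin k, A.extMap 1 (f.blockEquiv 1 1 i) = 𝟙 (A.extObj (Block f.1 i)) :=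
    fun i => A.extMap_refl _
  exact congrArg (tensorMap (Equiv.refl (Fin k))) (funext h)

theorem GSModule.blockMap_mul {G : Type} [Group G] (A : GSModule E G) {n k : ℕ}
    (x y : Wreath G k × Equiv.Perm (Fin n)) (f : Surj n k) :
    A.blockMap (x * y) f = A.blockMap y f ≫ A.blockMap x (f.act y.1.right y.2) := by
  refine Eq.trans ?_ (tensorMap_comp _ _ _ _)
  refine congrArg (tensorMap (y.1.right.trans x.1.right)) (funext fun i => ?_)
  refine Eq.trans ?_ (A.extMap_comp _ _ _ _)
  have h : (x * y).1.left ((x * y).1.right i) =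
      x.1.left (x.1.right (y.1.right i)) * y.1.left (y.1.right i) := by
    have h' : (mulAutArrow x.1.right y.1.left) (x.1.right (y.1.right i)) =
        y.1.left (y.1.right i) :=
      congrArg y.1.left (x.1.right.symm_apply_apply _)
    exact congrArg (x.1.left (x.1.right (y.1.right i)) * ·) h'
  rw [h]
  rfl

variable [HasFiniteColimits E]

/-- The component `(A^{⊗ k})(n)` of the `k`-fold tensor power of a `(G × 𝕊)`-module, i.e.
`⨁ Ind_{𝕊_{n₁} × ⋯ × 𝕊_{nₖ}}^{𝕊ₙ} A(n₁) ⊗ ⋯ ⊗ A(nₖ)` over `n₁ + ⋯ + nₖ = n` with all `nᵢ ≥ 1`,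
written as the sum over all ordered decompositions of the set `Fin n` into `k` nonempty blocks.
`𝕊ₙ` permutes the elements, `𝕊ₖ` the tensor factors, and `Gᵏ` acts factor by factor. -/
noncomputable def GSModule.tensorPower {G : Type} [Group G] (A : GSModule E G) (k n : ℕ) :
    Action E (Wreath G k × Equiv.Perm (Fin n)) where
  V := ∐ fun f : Surj n k => A.blockTensor f
  ρ :=
    { toFun x := Sigma.desc fun f => A.blockMap x f ≫
        Sigma.ι (fun f : Surj n k => A.blockTensor f) (f.act x.1.right x.2)
      map_one' := Sigma.hom_ext _ _ fun f => by
        rw [Sigma.ι_desc, A.blockMap_one]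
        exact (Category.id_comp _).trans (Category.comp_id _).symm
      map_mul' x y := Sigma.hom_ext _ _ fun f => by
        rw [Sigma.ι_desc, A.blockMap_mul]
        rw [End.mul_def, Sigma.ι_desc_assoc, Category.assoc, Sigma.ι_desc]
        exact Category.assoc _ _ _ }

/-! ### Induction, coinvariants and the plethysm -/

instance (H : Type) [Group H] [Finite H] : HasColimitsOfShape (SingleObj H) E :=
  have := Fintype.ofFinite H
  inferInstance

/-- The induced representation `Ind_H^Γ 𝟙` of the trivial representation on the unit object:
the sum of copies of the unit object indexed by the cosets `Γ ⧸ H`, permuted by `Γ`. -/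
noncomputable def indUnit {Γ : Type} [Group Γ] [Finite Γ] (H : Subgroup Γ) : Action E Γ where
  V := ∐ fun _ : Γ ⧸ H => 𝟙_ E
  ρ :=
    { toFun x := Sigma.desc fun c => Sigma.ι (fun _ : Γ ⧸ H => 𝟙_ E) (x • c)
      map_one' := Sigma.hom_ext _ _ fun c => by
        rw [Sigma.ι_desc, one_smul]
        exact (Category.comp_id _).symm
      map_mul' x y := Sigma.hom_ext _ _ fun c => by
        rw [Sigma.ι_desc, End.mul_def, Sigma.ι_desc_assoc, Sigma.ι_desc, mul_smul] }

/-- A representation of `H × K`, restricted to `H` and regarded as a diagram. -/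
def orbitDiagram {H K : Type} [Group H] [Group K] (A : Action E (H × K)) : SingleObj H ⥤ E where
  obj _ := A.V
  map h := A.ρ (h, 1)
  map_id _ := A.ρ.map_one
  map_comp x y := (congrArg A.ρ (by
    rw [SingleObj.comp_as_mul, Prod.mk_mul_mk, mul_one])).trans (A.ρ.map_mul (y, 1) (x, 1))

/-- The action of `K` commutes with that of `H`. -/
def orbitDiagramMap {H K : Type} [Group H] [Group K] (A : Action E (H × K)) (κ : K) :
    orbitDiagram A ⟶ orbitDiagram A where
  app _ := A.ρ (1, κ)
  naturality _ _ h := by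
    refine (A.ρ.map_mul (1, κ) (h, 1)).symm.trans (Eq.trans ?_ (A.ρ.map_mul (h, 1) (1, κ)))
    exact congrArg A.ρ (by simp)

/-- The `H`-coinvariants of a representation of `H × K`, as a representation of `K`. -/
noncomputable def coinvariants {H K : Type} [Group H] [Finite H] [Group K]
    (A : Action E (H × K)) : Action E K where
  V := colimit (orbitDiagram A)
  ρ :=
    { toFun κ := colimMap (orbitDiagramMap A κ)
      map_one' := colimit.hom_ext fun j => by
        rw [ι_colimMap]
        exact (congrArg (· ≫ colimit.ι (orbitDiagram A) j) A.ρ.map_one).trans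
          ((Category.id_comp _).trans (Category.comp_id _).symm)
      map_mul' x y := colimit.hom_ext fun j => by
        rw [ι_colimMap, End.mul_def, ι_colimMap_assoc, ι_colimMap, ← Category.assoc]
        refine congrArg (· ≫ colimit.ι (orbitDiagram A) j)
          (Eq.trans (congrArg A.ρ ?_) (A.ρ.map_mul (1, x) (1, y)))
        simp }

/-- The projection from a representation to its coinvariants. -/
noncomputable def coinvariantsMk {H K : Type} [Group H] [Finite H] [Group K]
    (A : Action E (H × K)) : A.V ⟶ (coinvariants A).V :=
  colimit.ι (orbitDiagram A) (SingleObj.star H)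

/-- The representation `W(k) ⊗ (A^{⊗ k})(n)` of `(G ≀ 𝕊ₖ) × 𝕊ₙ`: diagonal action of `G ≀ 𝕊ₖ`,
and `𝕊ₙ` acts on the second factor. -/
noncomputable def plethysmTensor {G : Type} [Group G] (W : WreathModule E G)
    (A : GSModule E G) (k n : ℕ) : Action E (Wreath G k × Equiv.Perm (Fin n)) :=
  (Action.res E (MonoidHom.fst (Wreath G k) (Equiv.Perm (Fin n)))).obj (W k) ⊗ A.tensorPower k n

/-- The plethysm `W ∘_G A`, with components `⨁_{k ≥ 0} W(k) ⊗_{G ≀ 𝕊ₖ} (A^{⊗ k})(n)`, where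
`W(k) ⊗_{G ≀ 𝕊ₖ} -` denotes the coinvariants of `W(k) ⊗ -` under `G ≀ 𝕊ₖ`.
There are no decompositions of `Fin n` into `k > n` nonempty blocks, so the terms with `k > n`
vanish and the sum runs over `0 ≤ k ≤ n`. -/
noncomputable def plethysm {G : Type} [Group G] [Finite G] (W : WreathModule E G)
    (A : GSModule E G) : SModule E := fun n =>
  ∐ fun k : Fin (n + 1) => coinvariants (plethysmTensor W A k n)

/-! ### Dihedral groups -/

/-- The dihedral group `Dₙ` inside the hyperoctahedral group `𝕊₂ ≀ 𝕊ₙ`, generated by `(1, τ)` and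
`(-1, σ)`, where `1 = (1, …, 1)`, `-1 = (-1, …, -1)`, `τ` is the `n`-cycle `i ↦ i + 1` and `σ` is
the reversal `i ↦ n + 1 - i`. -/
def dihedral (n : ℕ) : Subgroup (Wreath (Equiv.Perm (Fin 2)) n) :=
  Subgroup.closure {⟨fun _ => 1, finRotate n⟩, ⟨fun _ => Equiv.swap 0 1, Fin.revPerm⟩}

variable (E) in
/-- The `(𝕊₂ ≀ 𝕊)`-module `Dih`, with `Dih(n) = Ind_{Dₙ}^{𝕊₂ ≀ 𝕊ₙ} 𝟙`. -/
noncomputable def Dih : WreathModule E (Equiv.Perm (Fin 2)) := fun n => indUnit (dihedral n)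

/-- The canonical map `A(f⁻¹(1)) ⊗ ⋯ ⊗ A(f⁻¹(k)) ⟶ (Dih ∘_{𝕊₂} A)(n)`: it inserts the generator
of `Dih(k)` given by the trivial coset, and then projects to the coinvariants. -/
noncomputable def dihClass (A : GSModule E (Equiv.Perm (Fin 2))) {n : ℕ+} {k : Fin (n + 1)}
    (f : Surj n k) : A.blockTensor f ⟶ (plethysm (Dih E) A n).V :=
  (λ_ (A.blockTensor f)).inv ≫
    (Sigma.ι (fun _ : Wreath (Equiv.Perm (Fin 2)) k ⧸ dihedral k => 𝟙_ E)
      (QuotientGroup.mk 1) ⊗ₘ Sigma.ι (fun f : Surj n k => A.blockTensor f) f) ≫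
    coinvariantsMk (plethysmTensor (Dih E) A k n) ≫
    (Sigma.ι (fun k : Fin (n + 1) => coinvariants (plethysmTensor (Dih E) A k n)) k).hom

end Modules

/-! ### Graphs -/

/-- A graph with flags (half-edges) `F` and vertices `V`: a map `vert` that partitions the flags
into (possibly empty) blocks, one for each vertex, and an involution `inv` of the flags.
The fixed points of `inv` are the legs and its two-element orbits are the edges. -/
structure Graph (F V : Type) where
  vert : F → V
  inv : F → F
  inv_inv : ∀ x, inv (inv x) = x

namespace Graph
variable {F V : Type} (Γ : Graph F V)

/-- The flags at a vertex. -/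
abbrev FlagsAt (v : V) : Type := {x : F // Γ.vert x = v}

/-- The legs. -/
abbrev Legs : Type := {x : F // Γ.inv x = x}

/-- The connected components (edges identify their end points; legs do nothing). -/
def Components : Type := Quot fun v w : V => ∃ x, Γ.vert x = v ∧ Γ.vert (Γ.inv x) = w

/-- There is exactly one connected component. -/
def Connected : Prop := Nat.card Γ.Components = 1

/-- The number of edges: half the number of flags that are not legs. -/
noncomputable def numEdges : ℕ := Nat.card {x : F // Γ.inv x ≠ x} / 2

/-- The first Betti number of the geometric realization, by its Euler characteristic:
edges minus vertices plus components. -/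
noncomputable def b1 : ℤ := Γ.numEdges - Nat.card V + Nat.card Γ.Components

/-- Removing the edge that consists of the flags `x` and `inv x`. -/
def removeEdge (x : F) : Graph {y : F // y ≠ x ∧ y ≠ Γ.inv x} V where
  vert y := Γ.vert y
  inv y := ⟨Γ.inv y, fun h => y.2.2 ((Γ.inv_inv y).symm.trans (congrArg Γ.inv h)),
    fun h => y.2.1 ((Γ.inv_inv y).symm.trans ((congrArg Γ.inv h).trans (Γ.inv_inv x)))⟩
  inv_inv y := Subtype.ext (Γ.inv_inv y)

/-- A necklace: a connected graph with first Betti number one that is not disconnected by removing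
any edge. -/
def IsNecklace : Prop :=
  Γ.Connected ∧ Γ.b1 = 1 ∧ ∀ x, Γ.inv x ≠ x → (Γ.removeEdge x).Connected

end Graph

/-- A stable graph of type `(g, n)`: a connected graph with a genus for each vertex and with its
legs labelled by `1, …, n`, such that `2 g(v) - 2 + n(v) > 0` for each vertex `v` with `n(v)` flags
and such that the genera and the first Betti number add up to `g`. The sets of flags and vertices
are taken to be of the form `{0, …, m - 1}`; every finite graph is isomorphic to one of this
form. -/
structure StableGraph (g n : ℕ) where
  numFlags : ℕ
  numVerts : ℕ
  graph : Graph (Fin numFlags) (Fin numVerts)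
  genus : Fin numVerts → ℕ
  leg : Fin n ≃ graph.Legs
  connected : graph.Connected
  stable : ∀ v, 2 < 2 * genus v + Nat.card (graph.FlagsAt v)
  total_genus : (∑ v, genus v : ℕ) + graph.b1 = g

namespace StableGraph
variable {g n : ℕ}

/-- Isomorphisms of stable graphs, compatible with all the structure. -/
@[ext]
structure Hom (Γ Δ : StableGraph g n) where
  flags : Fin Γ.numFlags ≃ Fin Δ.numFlags
  verts : Fin Γ.numVerts ≃ Fin Δ.numVerts
  vert_flags : ∀ x, Δ.graph.vert (flags x) = verts (Γ.graph.vert x)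
  inv_flags : ∀ x, Δ.graph.inv (flags x) = flags (Γ.graph.inv x)
  genus_verts : ∀ v, Δ.genus (verts v) = Γ.genus v
  flags_leg : ∀ i, flags (Γ.leg i) = Δ.leg i

/-- The bijection between the flags at corresponding vertices. -/
def Hom.flagsAt {Γ Δ : StableGraph g n} (φ : Hom Γ Δ) (v : Fin Γ.numVerts) :
    Γ.graph.FlagsAt v ≃ Δ.graph.FlagsAt (φ.verts v) :=
  φ.flags.subtypeEquiv fun x => by rw [φ.vert_flags, φ.verts.injective.eq_iff]

/-- The groupoid `Γ((g, n))` of stable graphs of type `(g, n)`. -/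
instance : Category (StableGraph g n) where
  Hom := Hom
  id Γ := ⟨.refl _, .refl _, fun _ => rfl, fun _ => rfl, fun _ => rfl, fun _ => rfl⟩
  comp φ ψ :=
    { flags := φ.flags.trans ψ.flags
      verts := φ.verts.trans ψ.verts
      vert_flags x := by simp [φ.vert_flags, ψ.vert_flags]
      inv_flags x := by simp [φ.inv_flags, ψ.inv_flags]
      genus_verts v := by simp [φ.genus_verts, ψ.genus_verts]
      flags_leg i := by simp [φ.flags_leg, ψ.flags_leg] }

instance (Γ Δ : StableGraph g n) : Finite (Hom Γ Δ) :=
  Finite.of_injective (fun φ => (φ.flags, φ.verts)) fun _ _ h =>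
    Hom.ext (congrArg Prod.fst h) (congrArg Prod.snd h)

theorem bounds (Γ : StableGraph g n) : Γ.numFlags ≤ 6 * g + 3 * n ∧
    Γ.numVerts ≤ 6 * g + 3 * n ∧ ∀ v, Γ.genus v ≤ 6 * g + 3 * n := by
  classical
  have h1 : Γ.numFlags = n + Nat.card {x // Γ.graph.inv x ≠ x} := by
    have h := Nat.card_congr (Equiv.sumCompl fun x => Γ.graph.inv x = x)
    rw [Nat.card_sum, Nat.card_fin, ← Nat.card_congr Γ.leg, Nat.card_fin] at h
    exact h.symm
  have h2 : ∑ v, Nat.card (Γ.graph.FlagsAt v) = Γ.numFlags := by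
    rw [← Nat.card_sigma, Nat.card_congr (Equiv.sigmaFiberEquiv Γ.graph.vert), Nat.card_fin]
  have h3 : ∑ _v : Fin Γ.numVerts, 3 ≤ ∑ v, (2 * Γ.genus v + Nat.card (Γ.graph.FlagsAt v)) :=
    Finset.sum_le_sum fun v _ => Γ.stable v
  rw [Finset.sum_add_distrib, ← Finset.mul_sum, h2, Finset.sum_const, Finset.card_univ,
    Fintype.card_fin, smul_eq_mul] at h3
  have h4 := Γ.total_genus
  have h5 : Nat.card Γ.graph.Components = 1 := Γ.connected
  rw [Graph.b1, Graph.numEdges, h5, Nat.card_fin] at h4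
  have h6 : ∀ v, Γ.genus v ≤ ∑ v, Γ.genus v := fun v =>
    Finset.single_le_sum (fun _ _ => Nat.zero_le _) (Finset.mem_univ v)
  refine ⟨by omega, by omega, fun v => (h6 v).trans (by omega)⟩

instance : Finite (StableGraph g n) := by
  let B := 6 * g + 3 * n + 1
  let T := Σ (F : Fin B) (V : Fin B), (Fin F → Fin V) × (Fin F → Fin F) × (Fin V → Fin B) ×
    (Fin n → Fin F)
  refine Finite.of_injective (β := T) (fun Γ =>
    ⟨⟨Γ.numFlags, Nat.lt_succ_of_le Γ.bounds.1⟩, ⟨Γ.numVerts, Nat.lt_succ_of_le Γ.bounds.2.1⟩,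
      Γ.graph.vert, Γ.graph.inv, fun v => ⟨Γ.genus v, Nat.lt_succ_of_le (Γ.bounds.2.2 v)⟩,
      fun i => (Γ.leg i).1⟩) ?_
  intro Γ Δ h
  obtain ⟨F, V, ⟨vert, inv, _⟩, genus, leg, _, _, _⟩ := Γ
  obtain ⟨F', V', ⟨vert', inv', _⟩, genus', leg', _, _, _⟩ := Δ
  simp only [T, Sigma.mk.injEq, Fin.mk.injEq] at h
  obtain ⟨rfl, h⟩ := h
  simp only [heq_eq_eq, Sigma.mk.injEq, Fin.mk.injEq] at h
  obtain ⟨rfl, h⟩ := h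
  simp only [heq_eq_eq, Prod.mk.injEq] at h
  obtain ⟨rfl, rfl, h, h'⟩ := h
  obtain rfl : genus = genus' := funext fun v => Fin.mk.inj (congrFun h v)
  obtain rfl : leg = leg' := Equiv.ext fun i => Subtype.ext (congrFun h' i)
  rfl

/-- Relabelling the legs: the leg with label `i` obtains the label `σ i`. -/
def relabel (σ : Equiv.Perm (Fin n)) (Γ : StableGraph g n) : StableGraph g n :=
  { Γ with leg := σ.symm.trans Γ.leg }

end StableGraph

/-- A class of stable graphs that is closed under relabelling of the legs. -/
structure GraphClass (g n : ℕ) where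
  prop : StableGraph g n → Prop
  relabel : ∀ σ Γ, prop Γ → prop (Γ.relabel σ)

namespace GraphClass
variable {g n : ℕ}

/-- The class of all stable graphs of type `(g, n)`. -/
def all (g n : ℕ) : GraphClass g n := ⟨fun _ => True, fun _ _ h => h⟩

/-- The class of necklaces of genus-zero vertices. -/
def necklaces (n : ℕ) : GraphClass 1 n :=
  ⟨fun Γ => Γ.graph.IsNecklace ∧ ∀ v, Γ.genus v = 0, fun _ _ h => h⟩

/-- The stable graphs that belong to a class. -/
def Objects (P : GraphClass g n) : Type := {Γ : StableGraph g n // P.prop Γ}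

/-- The groupoid of stable graphs that belong to a class, with all their isomorphisms. -/
instance (P : GraphClass g n) : Category P.Objects where
  Hom Γ Δ := Γ.1 ⟶ Δ.1
  id Γ := 𝟙 Γ.1
  comp φ ψ := φ ≫ ψ

instance (P : GraphClass g n) : Finite P.Objects :=
  inferInstanceAs (Finite {Γ // P.prop Γ})

instance (P : GraphClass g n) (E : Type u) [Category.{v} E] [HasFiniteColimits E] :
    HasColimitsOfShape P.Objects E :=
  have := Fintype.ofFinite P.Objects
  have (Γ Δ : P.Objects) : Fintype (Γ ⟶ Δ) :=
    have : Finite (Γ ⟶ Δ) := inferInstanceAs (Finite (StableGraph.Hom Γ.1 Δ.1))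
    Fintype.ofFinite _
  have : FinCategory P.Objects := {}
  inferInstance

/-- Relabelling of the legs in a class of stable graphs. -/
def relabelObj (P : GraphClass g n) (σ : Equiv.Perm (Fin n)) (Γ : P.Objects) : P.Objects :=
  ⟨Γ.1.relabel σ, P.relabel σ Γ.1 Γ.2⟩

/-- Relabelling of the legs is functorial. -/
def relabelMap (P : GraphClass g n) (σ : Equiv.Perm (Fin n)) {Γ Δ : P.Objects} (φ : Γ ⟶ Δ) :
    P.relabelObj σ Γ ⟶ P.relabelObj σ Δ :=
  show StableGraph.Hom _ _ from
    let φ' : StableGraph.Hom Γ.1 Δ.1 := φ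
    ⟨φ'.flags, φ'.verts, φ'.vert_flags, φ'.inv_flags, φ'.genus_verts,
      fun i => φ'.flags_leg (σ.symm i)⟩

end GraphClass

/-! ### Stable `𝕊`-modules -/

/-- A stable `𝕊`-module: representations `V((g, n))` of `𝕊ₙ` in `E` for all `g, n ≥ 0`, with
`V((g, n)) = 0` if `2 g - 2 + n ≤ 0`. -/
structure StableSModule (E : Type u) [Category.{v} E] where
  obj : (g n : ℕ) → Action E (Equiv.Perm (Fin n))
  isZero : ∀ g n, 2 * g + n ≤ 2 → IsZero (obj g n).V

namespace StableSModule
variable {E : Type u} [Category.{v} E] (V : StableSModule E)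

/-- The `𝕊`-module `n ↦ V((g, n))`. -/
def a (g : ℕ) : SModule E := fun n => V.obj g n

/-- The action of a bijection `Fin m ≃ Fin n` (which forces `m = n`). -/
def reindex {g h m n : ℕ} (hg : g = h) (e : Fin m ≃ Fin n) : (V.obj g m).V ⟶ (V.obj h n).V :=
  have hm : m = n := Fin.equiv_iff_eq.1 ⟨e⟩
  eqToHom (by rw [hg, hm]) ≫ (V.obj h n).ρ ((finCongr hm).symm.trans e)

theorem reindex_self {g n : ℕ} (e : Fin n ≃ Fin n) :
    V.reindex (rfl : g = g) e = (V.obj g n).ρ e := by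
  simp [reindex]

theorem reindex_comp {g h i l m n : ℕ} (hg : g = h) (hh : h = i) (e : Fin l ≃ Fin m)
    (e' : Fin m ≃ Fin n) :
    V.reindex (hg.trans hh) (e.trans e') = V.reindex hg e ≫ V.reindex hh e' := by
  subst hg hh
  obtain rfl : l = m := Fin.equiv_iff_eq.1 ⟨e⟩
  obtain rfl : l = n := Fin.equiv_iff_eq.1 ⟨e'⟩
  rw [reindex_self, reindex_self, reindex_self]
  exact (V.obj g l).ρ.map_mul e' e

/-- The value `V((g, I))` on a finite set `I`: the object `V((g, n))`, `n = |I|`, where `Fin n` is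
identified with `I` by a chosen enumeration. -/
noncomputable def extObj (g : ℕ) (I : Type) [Finite I] : E := (V.obj g (Nat.card I)).V

/-- The action of a bijection `I ≃ J` on the values at finite sets. -/
noncomputable def extMap {g h : ℕ} {I J : Type} [Finite I] [Finite J] (hg : g = h) (e : I ≃ J) :
    V.extObj g I ⟶ V.extObj h J :=
  V.reindex hg (((Finite.equivFin I).symm.trans e).trans (Finite.equivFin J))

theorem extMap_refl (g : ℕ) (I : Type) [Finite I] :
    V.extMap (rfl : g = g) (Equiv.refl I) = 𝟙 (V.extObj g I) := by
  refine (V.reindex_self _).trans ?_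
  refine Eq.trans (congrArg (V.obj g (Nat.card I)).ρ ?_) (V.obj g (Nat.card I)).ρ.map_one
  ext; simp

theorem extMap_comp {g h i : ℕ} {I J K : Type} [Finite I] [Finite J] [Finite K] (hg : g = h)
    (hh : h = i) (e : I ≃ J) (e' : J ≃ K) :
    V.extMap (hg.trans hh) (e.trans e') = V.extMap hg e ≫ V.extMap hh e' := by
  refine Eq.trans ?_ (V.reindex_comp hg hh _ _)
  refine congrArg (V.reindex _) ?_
  ext; simp

variable [MonoidalCategory E] [SymmetricCategory E] {g n : ℕ}

/-- `V((Γ)) = ⨂_v V((g(v), Flags(v)))`, the tensor product over the vertices of `Γ`. -/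
noncomputable def graphObj (Γ : StableGraph g n) : E :=
  tensorFin fun v => V.extObj (Γ.genus v) (Γ.graph.FlagsAt v)

/-- The action of isomorphisms of graphs on `V((Γ))`. -/
noncomputable def graphMap {Γ Δ : StableGraph g n} (φ : Γ ⟶ Δ) : V.graphObj Γ ⟶ V.graphObj Δ :=
  tensorMap φ.verts fun v => V.extMap (φ.genus_verts v).symm (φ.flagsAt v)

theorem graphMap_id (Γ : StableGraph g n) : V.graphMap (𝟙 Γ) = 𝟙 (V.graphObj Γ) := by
  refine Eq.trans ?_ (tensorMap_id _)
  exact congrArg (tensorMap (Equiv.refl _)) (funext fun v => V.extMap_refl _ _)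

theorem graphMap_comp {Γ Δ Θ : StableGraph g n} (φ : Γ ⟶ Δ) (ψ : Δ ⟶ Θ) :
    V.graphMap (φ ≫ ψ) = V.graphMap φ ≫ V.graphMap ψ := by
  refine Eq.trans ?_ (tensorMap_comp _ _ _ _)
  refine congrArg (tensorMap (φ.verts.trans ψ.verts)) (funext fun v => ?_)
  exact V.extMap_comp (φ.genus_verts v).symm (ψ.genus_verts (φ.verts v)).symm (φ.flagsAt v)
    (ψ.flagsAt (φ.verts v))

/-- The functor `Γ ↦ V((Γ))` on a class of stable graphs. -/
noncomputable def graphFunctor (P : GraphClass g n) : P.Objects ⥤ E where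
  obj Γ := V.graphObj Γ.1
  map φ := V.graphMap φ
  map_id Γ := V.graphMap_id Γ.1
  map_comp φ ψ := V.graphMap_comp φ ψ

variable [HasFiniteColimits E]

/-- The canonical map from `V((Γ))` to the colimit over the class `P`. -/
noncomputable def graphSumMk (P : GraphClass g n) (Γ : P.Objects) :
    V.graphObj Γ.1 ⟶ colimit (V.graphFunctor P) :=
  colimit.ι (V.graphFunctor P) Γ

theorem graphSumMk_naturality (P : GraphClass g n) {Γ Δ : P.Objects} (φ : Γ ⟶ Δ) :
    V.graphMap φ ≫ V.graphSumMk P Δ = V.graphSumMk P Γ :=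
  colimit.w (V.graphFunctor P) φ

/-- A permutation `σ` of the labels acts on the colimit over `P` by the identity maps
`V((Γ)) = V((σ Γ))`, where `σ Γ` is the relabelled graph. -/
noncomputable def graphSumAct (P : GraphClass g n) (σ : Equiv.Perm (Fin n)) :
    colimit (V.graphFunctor P) ⟶ colimit (V.graphFunctor P) :=
  colimit.desc (V.graphFunctor P)
    { pt := _
      ι :=
        { app Γ := V.graphSumMk P (P.relabelObj σ Γ)
          naturality _ _ φ :=
            (V.graphSumMk_naturality P (P.relabelMap σ φ)).trans (Category.comp_id _).symm } }

theorem graphSumMk_act (P : GraphClass g n) (σ : Equiv.Perm (Fin n)) (Γ : P.Objects) :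
    V.graphSumMk P Γ ≫ V.graphSumAct P σ = V.graphSumMk P (P.relabelObj σ Γ) :=
  colimit.ι_desc _ _

/-- The sum over a class of stable graphs: the colimit of `V((Γ))` over the groupoid of graphs in
the class, i.e. the sum over isomorphism classes of the coinvariants `V((Γ))_{Aut Γ}`, with `𝕊ₙ`
acting by relabelling of the legs. -/
noncomputable def graphSum (P : GraphClass g n) : Action E (Equiv.Perm (Fin n)) where
  V := colimit (V.graphFunctor P)
  ρ :=
    { toFun σ := V.graphSumAct P σ
      map_one' := colimit.hom_ext fun Γ =>
        (V.graphSumMk_act P 1 Γ).trans (Category.comp_id _).symm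
      map_mul' σ τ := colimit.hom_ext fun Γ => by
        refine (V.graphSumMk_act P (σ * τ) Γ).trans (Eq.symm ?_)
        refine (Category.assoc _ _ _).symm.trans ?_
        refine (congrArg (· ≫ V.graphSumAct P σ) (V.graphSumMk_act P τ Γ)).trans ?_
        exact V.graphSumMk_act P σ (P.relabelObj τ Γ) }

/-- `𝕄V((g, n))`, the sum over all stable graphs of type `(g, n)`. -/
noncomputable def M (g n : ℕ) : Action E (Equiv.Perm (Fin n)) := V.graphSum (.all g n)

/-- The `𝕊`-module `n ↦ 𝕄V((g, n))`. -/
noncomputable def b (g : ℕ) : SModule E := fun n => V.M g n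

/-- The `𝕊`-module of (unordered) necklaces of genus-zero vertices. -/
noncomputable def necklaceModule : SModule E := fun n => V.graphSum (.necklaces n)

/-- The canonical map of colimits from the necklaces of genus-zero vertices to all stable graphs of
genus one. -/
noncomputable def necklaceInclusionHom (n : ℕ) :
    colimit (V.graphFunctor (.necklaces n)) ⟶ colimit (V.graphFunctor (.all 1 n)) :=
  colimit.desc (V.graphFunctor (.necklaces n))
    { pt := _
      ι :=
        { app Γ := V.graphSumMk (.all 1 n) ⟨Γ.1, trivial⟩
          naturality Γ Δ φ := (V.graphSumMk_naturality (.all 1 n) (Γ := ⟨Γ.1, trivial⟩)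
            (Δ := ⟨Δ.1, trivial⟩) φ).trans (Category.comp_id _).symm } }

theorem graphSumMk_necklaceInclusionHom (n : ℕ) (Γ : (GraphClass.necklaces n).Objects) :
    V.graphSumMk (.necklaces n) Γ ≫ V.necklaceInclusionHom n =
      V.graphSumMk (.all 1 n) ⟨Γ.1, trivial⟩ :=
  colimit.ι_desc _ _

/-- The canonical map of representations of `𝕊ₙ` from the sum over the necklaces of genus-zero
vertices to the sum over all stable graphs of genus one. -/
noncomputable def necklaceInclusion (n : ℕ+) : V.necklaceModule n ⟶ V.b 1 n where
  hom := V.necklaceInclusionHom n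
  comm σ := colimit.hom_ext fun Γ => by
    refine (Category.assoc _ _ _).symm.trans ?_
    refine (congrArg (· ≫ V.necklaceInclusionHom n)
      (V.graphSumMk_act (.necklaces n) σ Γ)).trans ?_
    refine (V.graphSumMk_necklaceInclusionHom n _).trans ?_
    refine Eq.trans ?_ (Category.assoc _ _ _)
    refine Eq.trans ?_ (congrArg (· ≫ V.graphSumAct (.all 1 n) σ)
      (V.graphSumMk_necklaceInclusionHom n Γ).symm)
    exact (V.graphSumMk_act (.all 1 n) σ ⟨Γ.1, trivial⟩).symm

end StableSModule

/-! ### Comparison of the plethysm with the sum over necklaces -/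

/-- A presentation of the stable graph `Γ` as the result of gluing `k` vertices in cyclic order.
The vertex with index `i` carries two marked flags, `flags i (inl 0)` and `flags i (inl 1)`, and
the legs with label in `f⁻¹(i)`; the second marked flag of the vertex `i` is joined to the first
marked flag of the vertex that follows `i` in the cyclic order. -/
structure CyclicGluing {n k : ℕ} (f : Fin n → Fin k) (Γ : StableGraph 1 n) where
  verts : Fin k ≃ Fin Γ.numVerts
  flags : ∀ i, Fin 2 ⊕ Block f i ≃ Γ.graph.FlagsAt (verts i)
  flags_inr : ∀ i (a : Block f i), (flags i (.inr a)).1 = (Γ.leg a.1).1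
  inv_flags : ∀ i, Γ.graph.inv (flags i (.inl 1)).1 = (flags (finRotate k i) (.inl 0)).1

variable {E : Type u} [Category.{v} E] [MonoidalCategory E] [SymmetricCategory E]

/-- The map `⨂ᵢ V((0, Fin 2 ⊔ f⁻¹(i))) ⟶ V((Γ))` given by a presentation of a graph with
genus-zero vertices as a cyclic gluing. -/
noncomputable def CyclicGluing.map (V : StableSModule E) {n k : ℕ} {f : Surj n k}
    {Γ : StableGraph 1 n} (c : CyclicGluing f.1 Γ) (h : ∀ v, Γ.genus v = 0) :
    ((V.a 0).restrict 2).blockTensor f ⟶ V.graphObj Γ :=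
  tensorMap c.verts fun i => V.reindex (h (c.verts i)).symm
    ((finSumFinEquiv.symm.trans (((Equiv.refl (Fin 2)).sumCongr
      (GSModule.enum (Block f.1 i)).symm).trans (c.flags i))).trans
      (Finite.equivFin (Γ.graph.FlagsAt (c.verts i))))

end Necklace

/-! Both sides are described by the maps out of them. Since `Dih(k)` is induced from the trivial
representation of the dihedral group, the coinvariants of `Dih(k) ⊗ X` under the whole wreath
product are the coinvariants of `X` under `dihedral k`. Hence a map from the plethysm to a
representation of `𝕊ₙ` amounts to a family of maps on the summands `blockTensor f`, invariant under
`dihedral k` and equivariant under `𝕊ₙ` (`plethysm_hom_ext`, `exists_plethysm_desc`). This uses that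
a biadditive tensor product distributes over finite coproducts. A map from the sum over necklaces is
an equivariant natural family of maps on the objects `V((Γ))`.

The two kinds of families are matched by cyclic gluing. Every surjection `f` can be glued to a
necklace (`exists_necklace`), and two graphs glued from the same `f` are isomorphic compatibly with
their presentations (`CyclicGluing.exists_iso`). Conversely, every necklace of genus-zero vertices
arises by gluing (`exists_cyclicGluing`), and two presentations of one graph differ by an element of
`𝕊₂ ≀ 𝕊ₖ` that commutes with the involution joining the marked flags
(`CyclicGluing.exists_mem_dihedral`). The elements commuting with this involution are exactly those
of the dihedral group (`dihedral_eq_joinStabilizer`): both groups contain the dihedral elements,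
which act transitively on the `2k` marked flags, and a commuting element that fixes one flag is
trivial. Gluing, and sending a necklace to the class of any presentation, are therefore well defined
and mutually inverse.

The graph-theoretic core is that a necklace is a cycle. Betti number one gives as many edges as
vertices, and the absence of bridges gives at least two edge flags at each vertex, hence exactly
two; walking along the edges then visits every vertex once (`Graph.IsNecklace.exists_marked`).
Stability forces a leg at each genus-zero vertex, which is why the blocks are nonempty.

The inclusion into all graphs splits because necklaces form a union of isomorphism classes:
extension by zero to the other graphs is a retraction. -/

namespace Necklace

/-! ### Distributivity of the tensor product over finite coproducts -/

section Distributivity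
variable {E : Type u} [Category.{v} E] [Preadditive E] [HasFiniteColimits E]

open Classical in
/-- The projection of a coproduct to one of its summands. -/
noncomputable def sigmaProj {ι : Type} [Finite ι] (X : ι → E) (i : ι) : ∐ X ⟶ X i :=
  Sigma.desc fun j => if h : j = i then eqToHom (congrArg X h) else 0

theorem ι_sigmaProj_self {ι : Type} [Finite ι] (X : ι → E) (i : ι) :
    Sigma.ι X i ≫ sigmaProj X i = 𝟙 (X i) := by
  simp [sigmaProj]

theorem ι_sigmaProj_of_ne {ι : Type} [Finite ι] (X : ι → E) {i j : ι} (h : j ≠ i) :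
    Sigma.ι X j ≫ sigmaProj X i = 0 := by
  simp [sigmaProj, h]

theorem sum_sigmaProj_ι {ι : Type} [Fintype ι] (X : ι → E) :
    ∑ i, sigmaProj X i ≫ Sigma.ι X i = 𝟙 (∐ X) := by
  refine Sigma.hom_ext _ _ fun j => ?_
  rw [Preadditive.comp_sum, Finset.sum_eq_single j, ← Category.assoc, ι_sigmaProj_self,
    Category.id_comp, Category.comp_id]
  · intro i _ hi
    rw [← Category.assoc, ι_sigmaProj_of_ne X hi.symm, zero_comp]
  · simp

variable [MonoidalCategory E] [MonoidalPreadditive E]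

/-- By biadditivity, the identity of the tensor product of the coproducts is the sum of the tensor
products of the idempotents belonging to the summands. No exactness of the tensor product is needed.
-/
theorem sigma_tensor_hom_ext {ι κ : Type} [Finite ι] [Finite κ] {X : ι → E} {Y : κ → E} {T : E}
    {φ ψ : (∐ X) ⊗ (∐ Y) ⟶ T}
    (h : ∀ i j, (Sigma.ι X i ⊗ₘ Sigma.ι Y j) ≫ φ = (Sigma.ι X i ⊗ₘ Sigma.ι Y j) ≫ ψ) :
    φ = ψ := by
  have := Fintype.ofFinite ι
  have := Fintype.ofFinite κ
  have h1 : 𝟙 ((∐ X) ⊗ (∐ Y)) = ∑ i, ∑ j, (sigmaProj X i ⊗ₘ sigmaProj Y j) ≫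
      (Sigma.ι X i ⊗ₘ Sigma.ι Y j) := by
    simp only [tensorHom_comp_tensorHom, ← tensor_sum, ← sum_tensor]
    rw [sum_sigmaProj_ι, sum_sigmaProj_ι, id_tensorHom_id]
  rw [← Category.id_comp φ, ← Category.id_comp ψ, h1]
  simp only [Preadditive.sum_comp, Category.assoc, h]

/-- Project to each pair of summands, apply the prescribed map there, and add up. -/
theorem exists_sigma_tensor_desc {ι κ : Type} [Finite ι] [Finite κ] {X : ι → E} {Y : κ → E}
    {T : E} (m : ∀ i j, X i ⊗ Y j ⟶ T) :
    ∃ φ : (∐ X) ⊗ (∐ Y) ⟶ T, ∀ i j, (Sigma.ι X i ⊗ₘ Sigma.ι Y j) ≫ φ = m i j := by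
  have := Fintype.ofFinite ι
  have := Fintype.ofFinite κ
  refine ⟨∑ i, ∑ j, (sigmaProj X i ⊗ₘ sigmaProj Y j) ≫ m i j, fun i j => ?_⟩
  simp only [Preadditive.comp_sum, tensorHom_comp_tensorHom_assoc]
  rw [Finset.sum_eq_single i, Finset.sum_eq_single j]
  · simp [ι_sigmaProj_self]
  · intro l _ hl
    rw [ι_sigmaProj_of_ne Y hl.symm, MonoidalPreadditive.tensor_zero, zero_comp]
  · simp
  · intro l _ hl
    refine Finset.sum_eq_zero fun j' _ => ?_
    rw [ι_sigmaProj_of_ne X hl.symm, MonoidalPreadditive.zero_tensor, zero_comp]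
  · simp

end Distributivity

/-! ### The universal property of the plethysm with `Dih` -/

section Plethysm
variable {E : Type u} [Category.{v} E] [HasFiniteColimits E]

theorem ρ_comp_coinvariantsMk {H K : Type} [Group H] [Finite H] [Group K]
    (A : Action E (H × K)) (h : H) : A.ρ (h, 1) ≫ coinvariantsMk A = coinvariantsMk A :=
  colimit.w (orbitDiagram A) (j := SingleObj.star H) (j' := SingleObj.star H) h

theorem coinvariantsMk_comp_ρ {H K : Type} [Group H] [Finite H] [Group K]
    (A : Action E (H × K)) (κ : K) :
    coinvariantsMk A ≫ (coinvariants A).ρ κ = A.ρ (1, κ) ≫ coinvariantsMk A :=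
  ι_colimMap (orbitDiagramMap A κ) (SingleObj.star H)

theorem coinvariants_hom_ext {H K : Type} [Group H] [Finite H] [Group K]
    {A : Action E (H × K)} {T : E} {φ ψ : (coinvariants A).V ⟶ T}
    (h : coinvariantsMk A ≫ φ = coinvariantsMk A ≫ ψ) : φ = ψ :=
  colimit.hom_ext fun _ => h

/-- The map from the coinvariants that is given by an invariant map. -/
noncomputable def coinvariantsDesc {H K : Type} [Group H] [Finite H] [Group K]
    (A : Action E (H × K)) {T : E} (m : A.V ⟶ T) (hm : ∀ h, A.ρ (h, 1) ≫ m = m) :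
    (coinvariants A).V ⟶ T :=
  colimit.desc (orbitDiagram A)
    { pt := T
      ι :=
        { app _ := m
          naturality _ _ h := (hm h).trans (Category.comp_id _).symm } }

theorem coinvariantsMk_desc {H K : Type} [Group H] [Finite H] [Group K]
    (A : Action E (H × K)) {T : E} (m : A.V ⟶ T) (hm : ∀ h, A.ρ (h, 1) ≫ m = m) :
    coinvariantsMk A ≫ coinvariantsDesc A m hm = m :=
  colimit.ι_desc _ _

variable [MonoidalCategory E] [SymmetricCategory E] (A : GSModule E (Equiv.Perm (Fin 2)))

/-- The inclusion of the summand of `Dih(k) ⊗ (A^{⊗ k})(n)` given by a coset and a surjection. -/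
noncomputable def cosetIncl {n k : ℕ} (c : Wreath (Equiv.Perm (Fin 2)) k ⧸ dihedral k)
    (f : Surj n k) : A.blockTensor f ⟶ (plethysmTensor (Dih E) A k n).V :=
  (λ_ (A.blockTensor f)).inv ≫
    (Sigma.ι (fun _ : Wreath (Equiv.Perm (Fin 2)) k ⧸ dihedral k => 𝟙_ E) c ⊗ₘ
      Sigma.ι (fun f : Surj n k => A.blockTensor f) f)

theorem cosetIncl_ρ {n k : ℕ} (c : Wreath (Equiv.Perm (Fin 2)) k ⧸ dihedral k)
    (f : Surj n k) (x : Wreath (Equiv.Perm (Fin 2)) k × Equiv.Perm (Fin n)) :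
    cosetIncl A c f ≫ (plethysmTensor (Dih E) A k n).ρ x =
      A.blockMap x f ≫ cosetIncl A (x.1 • c) (f.act x.1.right x.2) := by
  have h1 : Sigma.ι (fun _ : Wreath (Equiv.Perm (Fin 2)) k ⧸ dihedral k => 𝟙_ E) c ≫
      (indUnit (dihedral k)).ρ x.1 = Sigma.ι (fun _ => 𝟙_ E) (x.1 • c) := Sigma.ι_desc _ _
  have h2 : Sigma.ι (fun f : Surj n k => A.blockTensor f) f ≫ (A.tensorPower k n).ρ x =
      A.blockMap x f ≫ Sigma.ι (fun f : Surj n k => A.blockTensor f) (f.act x.1.right x.2) :=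
    Sigma.ι_desc _ _
  have h3 : (plethysmTensor (Dih E) A k n).ρ x =
    ((indUnit (dihedral k)).ρ x.1 ⊗ₘ (A.tensorPower k n).ρ x) := rfl
  rw [h3]
  refine (Category.assoc _ _ _).trans ?_
  refine (congrArg (_ ≫ ·) (tensorHom_comp_tensorHom _ _ _ _)).trans ?_
  refine (congrArg (_ ≫ ·) (congrArg₂ (· ⊗ₘ ·) h1 h2)).trans ?_
  have h4 : ∀ {X Y P Q : E} (a : 𝟙_ E ⟶ P) (b : X ⟶ Y) (c : Y ⟶ Q),
      (λ_ X).inv ≫ (a ⊗ₘ (b ≫ c)) = b ≫ (λ_ Y).inv ≫ (a ⊗ₘ c) := fun a b c => by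
    rw [← Category.id_comp a, ← tensorHom_comp_tensorHom, id_tensorHom,
      leftUnitor_inv_naturality_assoc, Category.id_comp]
  exact h4 _ _ _

/-- The summand of `(Dih ∘_{𝕊₂} A)(n)` of index `k`. -/
noncomputable def plethysmIncl (n : ℕ+) (k : Fin (n + 1)) :
    coinvariants (plethysmTensor (Dih E) A k n) ⟶ plethysm (Dih E) A n :=
  Sigma.ι (fun k : Fin (n + 1) => coinvariants (plethysmTensor (Dih E) A k n)) k

/-- The map `A(f⁻¹(1)) ⊗ ⋯ ⊗ A(f⁻¹(k)) ⟶ (Dih ∘_{𝕊₂} A)(n)` given by any coset. -/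
noncomputable def cosetClass {n : ℕ+} {k : Fin (n + 1)}
    (c : Wreath (Equiv.Perm (Fin 2)) k ⧸ dihedral k) (f : Surj n k) :
    A.blockTensor f ⟶ (plethysm (Dih E) A n).V :=
  cosetIncl A c f ≫ coinvariantsMk (plethysmTensor (Dih E) A k n) ≫ (plethysmIncl A n k).hom

theorem dihClass_eq {n : ℕ+} {k : Fin (n + 1)} (f : Surj n k) :
    dihClass A f = cosetClass A (QuotientGroup.mk 1) f :=
  (Category.assoc _ _ _).symm

theorem blockMap_cosetClass {n : ℕ+} {k : Fin (n + 1)}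
    (c : Wreath (Equiv.Perm (Fin 2)) k ⧸ dihedral k) (f : Surj n k)
    (h : Wreath (Equiv.Perm (Fin 2)) k) :
    A.blockMap (h, 1) f ≫ cosetClass A (h • c) (f.act h.right 1) = cosetClass A c f := by
  have h1 := cosetIncl_ρ A c f (h, 1)
  have h2 := ρ_comp_coinvariantsMk (plethysmTensor (Dih E) A k n) h
  rw [cosetClass, cosetClass, ← Category.assoc, ← h1, Category.assoc, reassoc_of% h2]

theorem cosetClass_ρ {n : ℕ+} {k : Fin (n + 1)}
    (c : Wreath (Equiv.Perm (Fin 2)) k ⧸ dihedral k) (f : Surj n k)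
    (τ : Equiv.Perm (Fin n)) :
    cosetClass A c f ≫ (plethysm (Dih E) A n).ρ τ =
      A.blockMap (1, τ) f ≫ cosetClass A c (f.act 1 τ) := by
  have h1 := cosetIncl_ρ A c f (1, τ)
  rw [one_smul] at h1
  have h2 := coinvariantsMk_comp_ρ (plethysmTensor (Dih E) A k n) τ
  have h3 := (plethysmIncl A n k).comm τ
  simp only [cosetClass, Category.assoc]
  rw [← h3, reassoc_of% h2, reassoc_of% h1]
  rfl

theorem dihClass_ρ {n : ℕ+} {k : Fin (n + 1)} (f : Surj n k) (τ : Equiv.Perm (Fin n)) :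
    dihClass A f ≫ (plethysm (Dih E) A n).ρ τ =
      A.blockMap (1, τ) f ≫ dihClass A (f.act 1 τ) := by
  rw [dihClass_eq, dihClass_eq, cosetClass_ρ]

/-- The cosets form one orbit, so in the coinvariants every coset can be moved to the trivial one.
The classes `dihClass` therefore generate the plethysm. -/
theorem cosetClass_eq_blockMap {n : ℕ+} {k : Fin (n + 1)}
    (h : Wreath (Equiv.Perm (Fin 2)) k) (f : Surj n k) :
    cosetClass A (QuotientGroup.mk h) f =
      A.blockMap (h⁻¹, 1) f ≫ dihClass A (f.act h⁻¹.right 1) := by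
  rw [dihClass_eq, ← blockMap_cosetClass A (QuotientGroup.mk h) f h⁻¹]
  have : h⁻¹ • (QuotientGroup.mk h : Wreath (Equiv.Perm (Fin 2)) k ⧸ dihedral k) =
      QuotientGroup.mk 1 := congrArg QuotientGroup.mk (inv_mul_cancel h)
  rw [this]

/-- The stabilizer of the trivial coset is the dihedral group, which is what makes this class
invariant. -/
theorem blockMap_dihClass {n : ℕ+} {k : Fin (n + 1)} (f : Surj n k)
    {d : Wreath (Equiv.Perm (Fin 2)) k} (hd : d ∈ dihedral (k : ℕ)) :
    A.blockMap (d, 1) f ≫ dihClass A (f.act d.right 1) = dihClass A f := by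
  rw [dihClass_eq, dihClass_eq, ← blockMap_cosetClass A (QuotientGroup.mk 1) f d]
  have : d • (QuotientGroup.mk 1 : Wreath (Equiv.Perm (Fin 2)) k ⧸ dihedral (k : ℕ)) =
      QuotientGroup.mk 1 := QuotientGroup.eq.2 (by simpa using inv_mem hd)
  rw [this]

variable [Preadditive E] [MonoidalPreadditive E]

theorem cosetIncl_hom_ext {n k : ℕ} {T : E} {φ ψ : (plethysmTensor (Dih E) A k n).V ⟶ T}
    (h : ∀ c f, cosetIncl A c f ≫ φ = cosetIncl A c f ≫ ψ) : φ = ψ := by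
  refine sigma_tensor_hom_ext fun c f => ?_
  refine (cancel_epi (λ_ (A.blockTensor f)).inv).1 ?_
  exact (Category.assoc _ _ _).symm.trans ((h c f).trans (Category.assoc _ _ _))

theorem exists_cosetIncl_desc {n k : ℕ} {T : E}
    (m : ∀ (_ : Wreath (Equiv.Perm (Fin 2)) k ⧸ dihedral k) (f : Surj n k),
      A.blockTensor f ⟶ T) :
    ∃ φ : (plethysmTensor (Dih E) A k n).V ⟶ T, ∀ c f, cosetIncl A c f ≫ φ = m c f := by
  obtain ⟨φ, h⟩ := exists_sigma_tensor_desc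
    (X := fun _ : Wreath (Equiv.Perm (Fin 2)) k ⧸ dihedral k => 𝟙_ E)
    (Y := fun f : Surj n k => A.blockTensor f) (fun c f => (λ_ _).hom ≫ m c f)
  refine ⟨φ, fun c f => ?_⟩
  refine (Category.assoc _ _ _).trans ((congrArg (_ ≫ ·) (h c f)).trans ?_)
  exact Iso.inv_hom_id_assoc _ _

theorem plethysm_hom_ext {n : ℕ+} {T : Action E (Equiv.Perm (Fin n))}
    {φ ψ : plethysm (Dih E) A n ⟶ T}
    (h : ∀ (k : Fin (n + 1)) (f : Surj n k),
      dihClass A f ≫ φ.hom = dihClass A f ≫ ψ.hom) : φ = ψ := by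
  refine Sigma.hom_ext _ _ fun k => Action.Hom.ext (coinvariants_hom_ext
    (cosetIncl_hom_ext A fun c f => ?_))
  obtain ⟨g, rfl⟩ := QuotientGroup.mk_surjective c
  have h1 := congrArg (A.blockMap (g⁻¹, 1) f ≫ ·) (h k (f.act g⁻¹.right 1))
  have h2 := cosetClass_eq_blockMap A g f
  have h3 : cosetClass A (QuotientGroup.mk g) f ≫ φ.hom =
      cosetClass A (QuotientGroup.mk g) f ≫ ψ.hom := by
    rw [h2]; simpa using h1
  simp only [cosetClass, Category.assoc, ← Action.comp_hom] at h3
  exact h3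

/-- A form of Frobenius reciprocity. Invariance under the stabilizer of the trivial coset is all
that is required to extend `γ` from that coset to the other ones. -/
theorem exists_plethysm_desc {n : ℕ+} (T : Action E (Equiv.Perm (Fin n)))
    (γ : ∀ (k : Fin (n + 1)) (f : Surj n k), A.blockTensor f ⟶ T.V)
    (hγ : ∀ (k : Fin (n + 1)) (f : Surj n k), ∀ d ∈ dihedral (k : ℕ),
      A.blockMap (d, 1) f ≫ γ k (f.act d.right 1) = γ k f)
    (hγ' : ∀ (k : Fin (n + 1)) (f : Surj n k) (τ : Equiv.Perm (Fin n)),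
      A.blockMap (1, τ) f ≫ γ k (f.act 1 τ) = γ k f ≫ T.ρ τ) :
    ∃ φ : plethysm (Dih E) A n ⟶ T, ∀ k f, dihClass A f ≫ φ.hom = γ k f := by
  -- The target of `blockMap x f` depends on `x`, so equal group elements are substituted only in
  -- composites with a fixed target.
  have h3 : ∀ {k : Fin (n + 1)} {f : Surj n k}
      (x y : Wreath (Equiv.Perm (Fin 2)) k × Equiv.Perm (Fin n)), x = y →
      A.blockMap x f ≫ γ k (f.act x.1.right x.2) =
        A.blockMap y f ≫ γ k (f.act y.1.right y.2) := by rintro k f x _ rfl; rfl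
  -- The value on the coset of `g` has to be translation by `g⁻¹` followed by `γ`. Dihedral
  -- invariance makes it independent of the representative.
  have key : ∀ (k : Fin (n + 1)) (f : Surj n k) (g g' : Wreath (Equiv.Perm (Fin 2)) k),
      (QuotientGroup.mk g : _ ⧸ dihedral (k : ℕ)) = QuotientGroup.mk g' →
      A.blockMap (g⁻¹, 1) f ≫ γ k (f.act g⁻¹.right 1) =
        A.blockMap (g'⁻¹, 1) f ≫ γ k (f.act g'⁻¹.right 1) := by
    intro k f g g' h
    have hd := QuotientGroup.eq.1 h.symm
    obtain ⟨d, hd', rfl⟩ : ∃ d ∈ dihedral (k : ℕ), g = g' * d := ⟨_, hd, by group⟩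
    rw [← hγ k (f.act g'⁻¹.right 1) d⁻¹ (inv_mem hd')]
    have h1 := A.blockMap_mul (d⁻¹, 1) (g'⁻¹, (1 : Equiv.Perm (Fin n))) f
    have h2 : (((g' * d)⁻¹, 1) : Wreath (Equiv.Perm (Fin 2)) k × Equiv.Perm (Fin n)) =
      (d⁻¹, 1) * (g'⁻¹, 1) := by simp
    refine (h3 _ _ h2).trans ?_
    rw [h1]
    exact Category.assoc _ _ _
  have hm : ∀ k : Fin (n + 1), ∃ m : (plethysmTensor (Dih E) A k n).V ⟶ T.V, ∀ g f,
      cosetIncl A (QuotientGroup.mk g) f ≫ m =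
        A.blockMap (g⁻¹, 1) f ≫ γ k (f.act g⁻¹.right 1) := by
    intro k
    obtain ⟨m, hm⟩ := exists_cosetIncl_desc A (k := k) (n := n) (T := T.V) fun c f =>
      A.blockMap (c.out⁻¹, 1) f ≫ γ k (f.act c.out⁻¹.right 1)
    exact ⟨m, fun g f => (hm _ f).trans (key k f _ _ (QuotientGroup.out_eq' _))⟩
  choose m hm using hm
  have hm1 : ∀ k f, cosetIncl A (QuotientGroup.mk 1) f ≫ m k = γ k f := by
    intro k f
    rw [hm]
    have := hγ k f 1⁻¹ (inv_mem (one_mem _))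
    exact this
  have hinv : ∀ (k : Fin (n + 1)) h, (plethysmTensor (Dih E) A k n).ρ (h, 1) ≫ m k = m k := by
    intro k h
    refine cosetIncl_hom_ext A fun c f => ?_
    obtain ⟨g, rfl⟩ := QuotientGroup.mk_surjective c
    rw [← Category.assoc, cosetIncl_ρ, Category.assoc]
    have h1 : h • (QuotientGroup.mk g : _ ⧸ dihedral (k : ℕ)) = QuotientGroup.mk (h * g) := rfl
    rw [h1, hm, hm]
    have h2 := A.blockMap_mul ((h * g)⁻¹, 1) (h, (1 : Equiv.Perm (Fin n))) f
    refine Eq.trans ?_ (h3 (((h * g)⁻¹, 1) * (h, 1)) (g⁻¹, 1) (by simp))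
    rw [h2]
    exact (Category.assoc _ _ _).symm
  -- The actions of the wreath product and of `𝕊ₙ` commute, so translation by `g⁻¹` can be exchanged
  -- with `τ`.
  have hequiv : ∀ (k : Fin (n + 1)) τ,
      (plethysmTensor (Dih E) A k n).ρ (1, τ) ≫ m k = m k ≫ T.ρ τ := by
    intro k τ
    refine cosetIncl_hom_ext A fun c f => ?_
    obtain ⟨g, rfl⟩ := QuotientGroup.mk_surjective c
    rw [← Category.assoc, cosetIncl_ρ, Category.assoc]
    have h1 : ((1 : Wreath (Equiv.Perm (Fin 2)) k), τ).1 •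
        (QuotientGroup.mk g : _ ⧸ dihedral (k : ℕ)) = QuotientGroup.mk g := one_smul _ _
    rw [h1, ← Category.assoc (cosetIncl A _ f), hm, hm, Category.assoc, ← hγ']
    have h2 := A.blockMap_mul (g⁻¹, 1) (1, τ) f
    have h2' := A.blockMap_mul (1, τ) (g⁻¹, 1) f
    have h4 := h3 (f := f) ((g⁻¹, 1) * (1, τ)) ((1, τ) * (g⁻¹, 1)) (by simp)
    rw [h2, h2'] at h4
    exact (Category.assoc _ _ _).symm.trans (h4.trans (Category.assoc _ _ _))
  have hdesc : ∃ φ : plethysm (Dih E) A n ⟶ T, ∀ k, (plethysmIncl A n k).hom ≫ φ.hom =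
      coinvariantsDesc _ (m k) (hinv k) := by
    let ψ : ∀ k : Fin (n + 1), coinvariants (plethysmTensor (Dih E) A k n) ⟶ T := fun k =>
      { hom := coinvariantsDesc _ (m k) (hinv k)
        comm τ := coinvariants_hom_ext (by
          rw [← Category.assoc, coinvariantsMk_comp_ρ, Category.assoc, coinvariantsMk_desc,
            hequiv, ← Category.assoc, coinvariantsMk_desc]) }
    have hψ : ∀ k, plethysmIncl A n k ≫ Sigma.desc ψ = ψ k := fun k => Sigma.ι_desc ψ k
    exact ⟨Sigma.desc ψ, fun k => congrArg Action.Hom.hom (hψ k)⟩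
  obtain ⟨φ, hφ⟩ := hdesc
  refine ⟨φ, fun k f => ?_⟩
  rw [dihClass_eq, cosetClass, Category.assoc, Category.assoc, hφ, coinvariantsMk_desc, hm1]

end Plethysm


/-! ### Invertibility of the structure maps -/

section Isomorphisms
variable {E : Type u} [Category.{v} E] [MonoidalCategory E] [SymmetricCategory E]

instance (A B C : E) : IsIso (swapFirst A B C) :=
  ⟨swapFirst B A C, swapFirst_swapFirst A B C, swapFirst_swapFirst B A C⟩

theorem Ins.isIso_map {ι : Type} (X : ι → E) {a : ι} {L L' : List ι} (i : Ins a L L') :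
    IsIso (i.map X) := by
  induction i with
  | here L => exact inferInstanceAs (IsIso (𝟙 _))
  | there b i ih =>
    exact inferInstanceAs (IsIso (swapFirst (X a) (X b) _ ≫ X b ◁ i.map X))

theorem Shuffle.isIso_map {ι κ : Type} {e : ι → κ} {X : ι → E} {Y : κ → E}
    (f : ∀ i, X i ⟶ Y (e i)) [∀ i, IsIso (f i)] {L : List ι} {L' : List κ}
    (s : Shuffle e L L') : IsIso (s.map f) := by
  induction s with
  | nil => exact inferInstanceAs (IsIso (𝟙 _))
  | cons i s ih =>
    have := i.isIso_map Y
    exact inferInstanceAs (IsIso ((f _ ⊗ₘ s.map f) ≫ i.map Y))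

theorem isIso_tensorMap {k l : ℕ} (e : Fin k ≃ Fin l) {X : Fin k → E} {Y : Fin l → E}
    (f : ∀ i, X i ⟶ Y (e i)) (hf : ∀ i, IsIso (f i)) : IsIso (tensorMap e f) :=
  Shuffle.isIso_map f _

end Isomorphisms

/-! ### Maps of tensor products induced by bijections of flags -/

namespace StableSModule
variable {E : Type u} [Category.{v} E] (V : StableSModule E)

theorem isIso_reindex {g h m n : ℕ} (hg : g = h) (e : Fin m ≃ Fin n) :
    IsIso (V.reindex hg e) := by
  refine ⟨V.reindex hg.symm e.symm, ?_, ?_⟩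
  · rw [← V.reindex_comp hg hg.symm, e.self_trans_symm, V.reindex_self]
    exact (V.obj g m).ρ.map_one
  · rw [← V.reindex_comp hg.symm hg, e.symm_trans_self, V.reindex_self]
    exact (V.obj h n).ρ.map_one

theorem restrict_reindex {m n : ℕ+} (g : Equiv.Perm (Fin 2)) (e : Fin m ≃ Fin n) :
    ((V.a 0).restrict 2).reindex g e = V.reindex (rfl : 0 = 0)
      (finSumFinEquiv.symm.trans ((Equiv.sumCongr g e).trans finSumFinEquiv)) := by
  obtain rfl : m = n := PNat.eq (Fin.equiv_iff_eq.1 ⟨e⟩)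
  rw [GSModule.reindex_self, reindex_self]
  rfl

variable [MonoidalCategory E] [SymmetricCategory E] {g n k : ℕ}

/-- The map `⨂ᵢ V((0, Fin 2 ⊔ f⁻¹(i))) ⟶ V((Γ))` given by an identification of the vertices of `Γ`
with `Fin k` and of the flags at the `i`-th vertex with `Fin 2 ⊔ f⁻¹(i)`. -/
noncomputable def flagMap {f : Surj n k} {Γ : StableGraph g n} (h : ∀ v, Γ.genus v = 0)
    (e : Fin k ≃ Fin Γ.numVerts) (u : ∀ i, Fin 2 ⊕ Block f.1 i ≃ Γ.graph.FlagsAt (e i)) :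
    ((V.a 0).restrict 2).blockTensor f ⟶ V.graphObj Γ :=
  tensorMap e fun i => V.reindex (h (e i)).symm
    ((finSumFinEquiv.symm.trans (((Equiv.refl (Fin 2)).sumCongr
      (GSModule.enum (Block f.1 i)).symm).trans (u i))).trans
      (Finite.equivFin (Γ.graph.FlagsAt (e i))))

/-- The values of `u` and `u'` are compared as flags of the whole graph, because their types agree
only once `e = e'` is known. -/
theorem flagMap_congr {f : Surj n k} {Γ : StableGraph g n} (h : ∀ v, Γ.genus v = 0)
    {e e' : Fin k ≃ Fin Γ.numVerts} {u : ∀ i, Fin 2 ⊕ Block f.1 i ≃ Γ.graph.FlagsAt (e i)}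
    {u' : ∀ i, Fin 2 ⊕ Block f.1 i ≃ Γ.graph.FlagsAt (e' i)} (he : ∀ i, e i = e' i)
    (hu : ∀ i x, (u i x).1 = (u' i x).1) : V.flagMap h e u = V.flagMap h e' u' := by
  obtain rfl : e = e' := Equiv.ext he
  obtain rfl : u = u' := funext fun i => Equiv.ext fun x => Subtype.ext (hu i x)
  rfl

theorem isIso_flagMap {f : Surj n k} {Γ : StableGraph g n} (h : ∀ v, Γ.genus v = 0)
    (e : Fin k ≃ Fin Γ.numVerts) (u : ∀ i, Fin 2 ⊕ Block f.1 i ≃ Γ.graph.FlagsAt (e i)) :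
    IsIso (V.flagMap h e u) :=
  isIso_tensorMap e _ fun _ => V.isIso_reindex _ _

/-- Together with `blockMap_flagMap` and `flagMap_congr`, this reduces identities between morphisms
to identities between bijections of flags. The chosen enumerations of finite sets cancel in the
composite. -/
theorem flagMap_graphMap {f : Surj n k} {Γ Δ : StableGraph g n} (h : ∀ v, Γ.genus v = 0)
    (h' : ∀ v, Δ.genus v = 0) (e : Fin k ≃ Fin Γ.numVerts)
    (u : ∀ i, Fin 2 ⊕ Block f.1 i ≃ Γ.graph.FlagsAt (e i)) (φ : Γ ⟶ Δ) :
    V.flagMap h e u ≫ V.graphMap φ =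
      V.flagMap h' (e.trans φ.verts) fun i => (u i).trans (φ.flagsAt (e i)) := by
  refine (tensorMap_comp _ _ _ _).symm.trans ?_
  refine congrArg (tensorMap (e.trans φ.verts)) (funext fun i => ?_)
  refine (V.reindex_comp _ _ _ _).symm.trans (congrArg (V.reindex _) ?_)
  exact Equiv.ext fun x => congrArg
    (fun y => Finite.equivFin (Δ.graph.FlagsAt (φ.verts (e i))) (φ.flagsAt (e i) y))
    (Equiv.symm_apply_apply _ _)

theorem blockMap_flagMap {f : Surj n k} {Γ : StableGraph g n} (h : ∀ v, Γ.genus v = 0)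
    (x : Wreath (Equiv.Perm (Fin 2)) k × Equiv.Perm (Fin n)) (e : Fin k ≃ Fin Γ.numVerts)
    (u : ∀ i, Fin 2 ⊕ Block (f.act x.1.right x.2).1 i ≃ Γ.graph.FlagsAt (e i)) :
    ((V.a 0).restrict 2).blockMap x f ≫ V.flagMap h e u =
      V.flagMap h (x.1.right.trans e) fun i =>
        (Equiv.sumCongr (x.1.left (x.1.right i)) (f.blockEquiv x.1.right x.2 i)).trans
          (u (x.1.right i)) := by
  refine (tensorMap_comp _ _ _ _).symm.trans ?_
  refine congrArg (tensorMap (x.1.right.trans e)) (funext fun i => ?_)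
  refine (congrArg (· ≫ _) (V.restrict_reindex _ _)).trans ?_
  refine (V.reindex_comp _ _ _ _).symm.trans (congrArg (V.reindex _) ?_)
  refine Equiv.ext fun y => ?_
  obtain ⟨y, rfl⟩ := finSumFinEquiv.surjective y
  rcases y with y | y <;> simp

end StableSModule


/-! ### The dihedral group as the symmetry group of the cyclic gluing -/

section Dihedral

/-- The involution of the marked flags `(i, s)` of `k` vertices that joins the second marked flag
of each vertex to the first marked flag of the next vertex in the cyclic order. -/
def joinPerm (k : ℕ) : Equiv.Perm (Fin k × Fin 2) where
  toFun p := if p.2 = 0 then ((finRotate k).symm p.1, 1) else (finRotate k p.1, 0)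
  invFun p := if p.2 = 0 then ((finRotate k).symm p.1, 1) else (finRotate k p.1, 0)
  left_inv := by rintro ⟨i, s⟩; fin_cases s <;> simp [-finRotate_apply, -finRotate_symm_apply]
  right_inv := by rintro ⟨i, s⟩; fin_cases s <;> simp [-finRotate_apply, -finRotate_symm_apply]

@[simp] theorem joinPerm_one {k : ℕ} (i : Fin k) : joinPerm k (i, 1) = (finRotate k i, 0) := rfl

@[simp] theorem joinPerm_zero {k : ℕ} (i : Fin k) :
    joinPerm k (i, 0) = ((finRotate k).symm i, 1) := rfl

theorem joinPerm_joinPerm {k : ℕ} (p : Fin k × Fin 2) : joinPerm k (joinPerm k p) = p :=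
  (joinPerm k).left_inv p

/-- First marked flags are joined only to second ones. So there are no fixed points even for `k =
1`, where the edge is a loop. -/
theorem joinPerm_snd_ne {k : ℕ} (p : Fin k × Fin 2) : (joinPerm k p).2 ≠ p.2 := by
  obtain ⟨i, s⟩ := p; fin_cases s <;> simp

/-- The action of `𝕊₂ ≀ 𝕊ₖ` on the marked flags of `k` vertices. -/
def wreathPerm (k : ℕ) : Wreath (Equiv.Perm (Fin 2)) k →* Equiv.Perm (Fin k × Fin 2) where
  toFun x :=
    { toFun p := (x.right p.1, x.left (x.right p.1) p.2)
      invFun p := (x.right.symm p.1, (x.left p.1).symm p.2)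
      left_inv p := by simp
      right_inv p := by simp }
  map_one' := by ext p <;> simp
  map_mul' x y := by
    ext p
    · simp
    · have h : (mulAutArrow x.right y.left) (x.right (y.right p.1)) = y.left (y.right p.1) :=
        congrArg y.left (x.right.symm_apply_apply _)
      exact congrArg (fun g : Equiv.Perm (Fin 2) =>
        ((x.left (x.right (y.right p.1)) (g p.2) : Fin 2) : ℕ)) h

theorem wreathPerm_apply {k : ℕ} (x : Wreath (Equiv.Perm (Fin 2)) k) (i : Fin k) (s : Fin 2) :
    wreathPerm k x (i, s) = (x.right i, x.left (x.right i) s) := rfl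

/-- The elements of `𝕊₂ ≀ 𝕊ₖ` that are compatible with the cyclic gluing. -/
def joinStabilizer (k : ℕ) : Subgroup (Wreath (Equiv.Perm (Fin 2)) k) :=
  (Subgroup.centralizer {joinPerm k}).comap (wreathPerm k)

theorem mem_joinStabilizer {k : ℕ} {x : Wreath (Equiv.Perm (Fin 2)) k} :
    x ∈ joinStabilizer k ↔ ∀ p, wreathPerm k x (joinPerm k p) = joinPerm k (wreathPerm k x p) := by
  rw [joinStabilizer, Subgroup.mem_comap, Subgroup.mem_centralizer_singleton_iff]
  exact Equiv.ext_iff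

/-- Rigidity: fixing one marked flag forces fixing its vertex, then the other marked flag there,
then the flag joined to that one, and so on around the cycle. -/
theorem eq_one_of_mem_joinStabilizer {m : ℕ} {x : Wreath (Equiv.Perm (Fin 2)) (m + 1)}
    (hx : x ∈ joinStabilizer (m + 1)) (h0 : wreathPerm _ x (0, 0) = (0, 0)) : x = 1 := by
  rw [mem_joinStabilizer] at hx
  -- A permutation of two elements that fixes `0` is trivial.
  have step : ∀ i, wreathPerm _ x (i, 0) = (i, 0) → x.right i = i ∧ x.left i = 1 := by
    intro i hi
    rw [wreathPerm_apply, Prod.mk.injEq] at hi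
    obtain ⟨h1, h2⟩ := hi
    rw [h1] at h2
    refine ⟨h1, ?_⟩
    generalize x.left i = g at h2
    revert g
    decide
  have h : ∀ i, wreathPerm _ x (i, 0) = (i, 0) := by
    intro i
    induction i using Fin.induction with
    | zero => exact h0
    | succ i ih =>
      obtain ⟨h1, h2⟩ := step _ ih
      have h3 := hx (i.castSucc, 1)
      rw [wreathPerm_apply x i.castSucc, h1, h2] at h3
      simpa using h3
  refine SemidirectProduct.ext (funext fun i => (step i (h i)).2)
    (Equiv.ext fun i => (step i (h i)).1)

theorem rotation_mem_dihedral (k : ℕ) :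
    (⟨fun _ => 1, finRotate k⟩ : Wreath (Equiv.Perm (Fin 2)) k) ∈ dihedral k :=
  Subgroup.subset_closure (by simp)

theorem reflection_mem_dihedral (k : ℕ) :
    (⟨fun _ => Equiv.swap 0 1, Fin.revPerm⟩ : Wreath (Equiv.Perm (Fin 2)) k) ∈ dihedral k :=
  Subgroup.subset_closure (by simp)

/-- Rotations reach every vertex, and a reflection exchanges first and second marked flags. -/
theorem exists_mem_dihedral_apply {m : ℕ} (i : Fin (m + 1)) (s : Fin 2) :
    ∃ d ∈ dihedral (m + 1), wreathPerm _ d (0, 0) = (i, s) := by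
  have rot : ∀ {i : Fin (m + 1)} {s : Fin 2},
      (∃ d ∈ dihedral (m + 1), wreathPerm _ d (0, 0) = (i, s)) →
      ∃ d ∈ dihedral (m + 1), wreathPerm _ d (0, 0) = (i + 1, s) := by
    rintro i s ⟨d, hd, h⟩
    refine ⟨_, mul_mem (rotation_mem_dihedral _) hd, ?_⟩
    rw [map_mul, Equiv.Perm.mul_apply, h, wreathPerm_apply]
    simp
  induction i using Fin.induction with
  | zero =>
    fin_cases s
    · exact ⟨1, one_mem _, by simp⟩
    -- The reflection takes `(0, 0)` to the second flag of the last vertex, and one further rotation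
    -- brings this to vertex `0`.
    · have := rot (i := Fin.last m) (s := 1) ⟨_, reflection_mem_dihedral _, by
        simp [wreathPerm_apply]⟩
      simpa using this
  | succ i ih => simpa using rot ih

/-- It suffices to check the generators. A reversal turns the direction of the cycle around, and the
simultaneous swap of the marked flags compensates for this. -/
theorem dihedral_le_joinStabilizer (k : ℕ) : dihedral k ≤ joinStabilizer k := by
  refine (Subgroup.closure_le _).2 ?_
  rintro x (rfl | rfl) <;> refine mem_joinStabilizer.2 ?_ <;> rintro ⟨i, s⟩
  · fin_cases s
    · exact Prod.ext (((finRotate k).apply_symm_apply i).trans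
        ((finRotate k).symm_apply_apply i).symm) rfl
    · rfl
  · have hrev : ∀ i : Fin k, finRotate k (finRotate k i).rev = i.rev := by
      cases k with
      | zero => exact fun i => i.elim0
      | succ m =>
        intro i
        rw [finRotate_apply, finRotate_apply, Fin.rev_add, sub_add_cancel]
    fin_cases s
    · refine Prod.ext ?_ rfl
      have := hrev ((finRotate k).symm i)
      rw [Equiv.apply_symm_apply] at this
      exact this.symm
    · refine Prod.ext ?_ rfl
      exact (Equiv.eq_symm_apply _).2 (hrev i)

/-- For `k ≥ 1` an element `x` of the stabilizer and a suitable dihedral `d` agree on the marked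
flag `(0, 0)`, so `d⁻¹ * x` is trivial by rigidity. Acting on marked flags rather than on vertices
makes `k = 1` and `k = 2` no exceptions. -/
theorem dihedral_eq_joinStabilizer (k : ℕ) : dihedral k = joinStabilizer k := by
  refine le_antisymm (dihedral_le_joinStabilizer k) fun x hx => ?_
  cases k with
  | zero =>
    have : x = 1 := SemidirectProduct.ext (funext fun i => i.elim0) (Equiv.ext fun i => i.elim0)
    rw [this]
    exact one_mem _
  | succ m =>
    obtain ⟨d, hd, h⟩ := exists_mem_dihedral_apply (wreathPerm _ x (0, 0)).1
      (wreathPerm _ x (0, 0)).2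
    have h1 : d⁻¹ * x = 1 := eq_one_of_mem_joinStabilizer
      (mul_mem (inv_mem (dihedral_le_joinStabilizer _ hd)) hx) (by
        rw [map_mul, Equiv.Perm.mul_apply, map_inv, Equiv.Perm.inv_eq_iff_eq, h])
    rwa [← inv_mul_eq_one.1 h1]

theorem mem_dihedral_iff {k : ℕ} {x : Wreath (Equiv.Perm (Fin 2)) k} :
    x ∈ dihedral k ↔ ∀ p, wreathPerm k x (joinPerm k p) = joinPerm k (wreathPerm k x p) := by
  rw [dihedral_eq_joinStabilizer, mem_joinStabilizer]

end Dihedral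

theorem Graph.inv_injective {F V : Type} (Γ : Graph F V) : Function.Injective Γ.inv :=
  Function.LeftInverse.injective Γ.inv_inv

/-! ### Presentations of a graph as a cyclic gluing -/

namespace CyclicGluing

section Flags
variable {n k : ℕ} {f : Fin n → Fin k} {Γ : StableGraph 1 n} (c : CyclicGluing f Γ)

theorem vert_flags (i : Fin k) (x : Fin 2 ⊕ Block f i) :
    Γ.graph.vert (c.flags i x).1 = c.verts i := (c.flags i x).2

theorem vert_leg (a : Fin n) : Γ.graph.vert (Γ.leg a).1 = c.verts (f a) := by
  rw [← c.flags_inr (f a) ⟨a, rfl⟩, c.vert_flags]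

/-- All flags of a graph that is presented as a cyclic gluing. -/
noncomputable def flagEquiv : (Σ i, Fin 2 ⊕ Block f i) ≃ Fin Γ.numFlags :=
  (Equiv.sigmaCongr c.verts c.flags).trans (Equiv.sigmaFiberEquiv Γ.graph.vert)

theorem flagEquiv_apply (i : Fin k) (x : Fin 2 ⊕ Block f i) :
    c.flagEquiv ⟨i, x⟩ = (c.flags i x).1 := rfl

theorem inv_flags_inr (i : Fin k) (a : Block f i) :
    Γ.graph.inv (c.flags i (.inr a)).1 = (c.flags i (.inr a)).1 := by
  rw [c.flags_inr]
  exact (Γ.leg a.1).2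

theorem inv_flags_inl (i : Fin k) (s : Fin 2) :
    Γ.graph.inv (c.flags i (.inl s)).1 =
      (c.flags (joinPerm k (i, s)).1 (.inl (joinPerm k (i, s)).2)).1 := by
  fin_cases s
  · have := c.inv_flags ((finRotate k).symm i)
    rw [Equiv.apply_symm_apply] at this
    rw [← Γ.graph.inv_injective.eq_iff, Γ.graph.inv_inv]
    exact this.symm
  · exact c.inv_flags i

theorem flags_inl_injective {i j : Fin k} {s t : Fin 2}
    (h : (c.flags i (.inl s)).1 = (c.flags j (.inl t)).1) : (i, s) = (j, t) := by
  have := c.flagEquiv.injective (a₁ := ⟨i, .inl s⟩) (a₂ := ⟨j, .inl t⟩) h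
  cases this
  rfl

theorem inv_flags_inl_ne (i : Fin k) (s : Fin 2) :
    Γ.graph.inv (c.flags i (.inl s)).1 ≠ (c.flags i (.inl s)).1 := fun h =>
  joinPerm_snd_ne (i, s) (congrArg Prod.snd
    (c.flags_inl_injective ((c.inv_flags_inl i s).symm.trans h)))

/-- The flags that are not legs of a graph that is presented as a cyclic gluing. -/
noncomputable def marked : Fin k × Fin 2 ≃ {x // Γ.graph.inv x ≠ x} :=
  Equiv.ofBijective (fun p => ⟨(c.flags p.1 (.inl p.2)).1, c.inv_flags_inl_ne p.1 p.2⟩)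
    ⟨fun _ _ h => c.flags_inl_injective (congrArg Subtype.val h), fun ⟨x, hx⟩ => by
      obtain ⟨⟨i, y⟩, rfl⟩ := c.flagEquiv.surjective x
      rcases y with s | a
      · exact ⟨(i, s), rfl⟩
      · exact absurd (c.inv_flags_inr i a) hx⟩

theorem vert_marked (p : Fin k × Fin 2) : Γ.graph.vert (c.marked p).1 = c.verts p.1 :=
  c.vert_flags _ _

theorem inv_marked (p : Fin k × Fin 2) :
    Γ.graph.inv (c.marked p).1 = (c.marked (joinPerm k p)).1 := c.inv_flags_inl _ _

end Flags

/-- A cyclic gluing from an enumeration of the vertices and of the flags that are not legs. -/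
theorem nonempty_of_marked {n k : ℕ} {f : Fin n → Fin k} {Γ : StableGraph 1 n}
    (e : Fin k ≃ Fin Γ.numVerts) (N : Fin k × Fin 2 ≃ {x // Γ.graph.inv x ≠ x})
    (hv : ∀ p, Γ.graph.vert (N p).1 = e p.1)
    (hN : ∀ p, Γ.graph.inv (N p).1 = (N (joinPerm k p)).1)
    (hf : ∀ a, Γ.graph.vert (Γ.leg a).1 = e (f a)) : Nonempty (CyclicGluing f Γ) := by
  -- The flags at a vertex are of two disjoint kinds: those on edges, enumerated by `N`, and the
  -- legs, whose labels form the block of `f`.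
  have hbij : ∀ i, Function.Bijective (Sum.elim
      (fun s => (⟨(N (i, s)).1, hv (i, s)⟩ : Γ.graph.FlagsAt (e i)))
      (fun a : Block f i => ⟨(Γ.leg a.1).1, (hf a.1).trans (congrArg e a.2)⟩)) := by
    intro i
    constructor
    · rintro (s | a) (t | b) h <;> have h' := congrArg Subtype.val h
      · have := N.injective (Subtype.ext h')
        rw [(Prod.mk.inj this).2]
      · refine absurd ?_ (N (i, s)).2
        change (N (i, s)).1 = (Γ.leg b.1).1 at h'
        rw [h']
        exact (Γ.leg b.1).2
      · refine absurd ?_ (N (i, t)).2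
        change (Γ.leg a.1).1 = (N (i, t)).1 at h'
        rw [← h']
        exact (Γ.leg a.1).2
      · rw [Subtype.ext (Γ.leg.injective (Subtype.ext h'))]
    · rintro ⟨x, hx⟩
      by_cases hl : Γ.graph.inv x = x
      · obtain ⟨a, ha⟩ := Γ.leg.surjective ⟨x, hl⟩
        have ha' : (Γ.leg a).1 = x := congrArg Subtype.val ha
        refine ⟨.inr ⟨a, e.injective ?_⟩, Subtype.ext ha'⟩
        rw [← hf, ha', hx]
      · obtain ⟨⟨j, s⟩, hp⟩ := N.surjective ⟨x, hl⟩
        have hp' : (N (j, s)).1 = x := congrArg Subtype.val hp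
        obtain rfl : j = i := e.injective (by rw [← hv (j, s), hp', hx])
        exact ⟨.inl s, Subtype.ext hp'⟩
  exact ⟨{
    verts := e
    flags i := Equiv.ofBijective _ (hbij i)
    flags_inr i a := rfl
    inv_flags i := hN (i, 1) }⟩

variable {E : Type u} [Category.{v} E] [MonoidalCategory E] [SymmetricCategory E]
  (V : StableSModule E)

instance isIso_map {n k : ℕ} {f : Surj n k} {Γ : StableGraph 1 n} (c : CyclicGluing f.1 Γ)
    (h : ∀ v, Γ.genus v = 0) : IsIso (c.map V h) := V.isIso_flagMap h _ _

/-- An isomorphism of graphs carries a presentation of the source to one of the target, with the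
same decomposition of the labels. -/
theorem exists_transport {n k : ℕ} {f : Surj n k} {Γ Δ : StableGraph 1 n}
    (c : CyclicGluing f.1 Γ) (h : ∀ v, Γ.genus v = 0) (h' : ∀ v, Δ.genus v = 0) (φ : Γ ⟶ Δ) :
    ∃ c' : CyclicGluing f.1 Δ, c.map V h ≫ V.graphMap φ = c'.map V h' :=
  ⟨{ verts := c.verts.trans φ.verts
     flags i := (c.flags i).trans (φ.flagsAt (c.verts i))
     flags_inr i a := (congrArg φ.flags (c.flags_inr i a)).trans (φ.flags_leg a.1)
     inv_flags i := (φ.inv_flags _).trans (congrArg φ.flags (c.inv_flags i)) },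
    V.flagMap_graphMap h h' c.verts c.flags φ⟩

/-- Two graphs obtained by cyclic gluing from the same decomposition of the labels are
isomorphic. -/
theorem exists_iso {n k : ℕ} {f : Surj n k} {Γ Δ : StableGraph 1 n}
    (c : CyclicGluing f.1 Γ) (c' : CyclicGluing f.1 Δ) (h : ∀ v, Γ.genus v = 0)
    (h' : ∀ v, Δ.genus v = 0) : ∃ φ : Γ ⟶ Δ, c.map V h ≫ V.graphMap φ = c'.map V h' := by
  have hfl : ∀ i x, c'.flagEquiv (c.flagEquiv.symm (c.flags i x).1) = (c'.flags i x).1 := by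
    intro i x
    rw [← c.flagEquiv_apply, Equiv.symm_apply_apply, c'.flagEquiv_apply]
  have hve : ∀ i, c'.verts (c.verts.symm (c.verts i)) = c'.verts i := fun i => by
    rw [Equiv.symm_apply_apply]
  -- A presentation enumerates all flags and determines incidence, involution and labels in terms of
  -- `f`. Matching the two enumerations is therefore an isomorphism.
  let φ : StableGraph.Hom Γ Δ :=
    { flags := c.flagEquiv.symm.trans c'.flagEquiv
      verts := c.verts.symm.trans c'.verts
      vert_flags x := by
        obtain ⟨⟨i, x⟩, rfl⟩ := c.flagEquiv.surjective x
        simp only [Equiv.trans_apply, flagEquiv_apply, hfl, vert_flags, hve]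
      inv_flags x := by
        obtain ⟨⟨i, x⟩, rfl⟩ := c.flagEquiv.surjective x
        rcases x with s | a
        · simp only [Equiv.trans_apply, flagEquiv_apply, hfl, inv_flags_inl]
        · simp only [Equiv.trans_apply, flagEquiv_apply, hfl, inv_flags_inr]
      genus_verts v := by rw [h, h']
      flags_leg a := by
        rw [← c.flags_inr (f.1 a) ⟨a, rfl⟩, ← c'.flags_inr (f.1 a) ⟨a, rfl⟩]
        exact hfl _ _ }
  exact ⟨φ, (V.flagMap_graphMap h h' c.verts c.flags φ).trans
    (V.flagMap_congr h' hve hfl)⟩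

/-- Symmetries of the cyclic gluing and permutations of the labels act on presentations. -/
theorem exists_act {n k : ℕ} {f : Surj n k} {Γ : StableGraph 1 n} (c : CyclicGluing f.1 Γ)
    (h : ∀ v, Γ.genus v = 0) (x : Wreath (Equiv.Perm (Fin 2)) k × Equiv.Perm (Fin n))
    (hx : x.1 ∈ dihedral k) :
    ∃ c' : CyclicGluing (f.act x.1.right x.2).1 (Γ.relabel x.2),
      ((V.a 0).restrict 2).blockMap x f ≫ c'.map V h = c.map V h := by
  have hbl : ∀ j a, (f.act x.1.right x.2).1 a = j ↔ f.1 (x.2.symm a) = x.1.right.symm j :=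
    fun j a => (Equiv.eq_symm_apply _).symm
  -- The vertex `j` of the new presentation is the vertex `σ⁻¹ j` of the old one, so it is the
  -- inverse of `x.1` that has to commute with `joinPerm`.
  have hx' := mem_dihedral_iff.1 (inv_mem hx)
  rw [map_inv] at hx'
  let c' : CyclicGluing (f.act x.1.right x.2).1 (Γ.relabel x.2) :=
    { verts := x.1.right.symm.trans c.verts
      flags j := (Equiv.sumCongr (x.1.left j).symm
        (x.2.symm.subtypeEquiv (hbl j))).trans (c.flags (x.1.right.symm j))
      flags_inr j a := c.flags_inr _ _
      inv_flags j := (c.inv_marked ((wreathPerm k x.1)⁻¹ (j, 1))).trans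
        (congrArg (fun p => (c.marked p).1) (hx' (j, 1)).symm) }
  refine ⟨c', (V.blockMap_flagMap (Γ := Γ.relabel x.2) h x c'.verts c'.flags).trans
    (V.flagMap_congr (Γ := Γ) h (fun i => congrArg c.verts (x.1.right.symm_apply_apply i))
    fun i y => ?_)⟩
  -- The indices `σ⁻¹ (σ i)` and `i` are equal only propositionally, so elements of their blocks are
  -- compared as labels.
  have hdep : ∀ (i i' : Fin k) (hi : i = i') (y : Fin 2 ⊕ Block f.1 i)
      (y' : Fin 2 ⊕ Block f.1 i') (hy : Sum.map id Subtype.val y = Sum.map id Subtype.val y'),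
      (c.flags i y).1 = (c.flags i' y').1 := by
    rintro i _ rfl y y' hy
    rw [(Function.injective_id.sumMap Subtype.val_injective) hy]
  refine hdep _ _ (x.1.right.symm_apply_apply i) _ _ ?_
  rcases y with s | a
  · exact congrArg Sum.inl ((x.1.left (x.1.right i)).symm_apply_apply s)
  · exact congrArg Sum.inr (x.2.symm_apply_apply a.1)

/-- Two presentations of the same graph differ by a symmetry of the cyclic gluing. -/
theorem exists_mem_dihedral {n k : ℕ} {f f' : Surj n k} {Γ : StableGraph 1 n}
    (c : CyclicGluing f.1 Γ) (c' : CyclicGluing f'.1 Γ) :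
    ∃ d ∈ dihedral k, f.act d.right 1 = f' ∧ (∀ i, c'.verts (d.right i) = c.verts i) ∧
      ∀ p, (c'.marked (wreathPerm k d p)).1 = (c.marked p).1 := by
  -- The two enumerations of edge flags differ by `p` and those of vertices by `σ`. As `p` lies over
  -- `σ`, it comes from an element `d` of the wreath product.
  let p : Equiv.Perm (Fin k × Fin 2) := c.marked.trans c'.marked.symm
  let σ : Equiv.Perm (Fin k) := c.verts.trans c'.verts.symm
  have hσ : ∀ i, c'.verts (σ i) = c.verts i := fun i => c'.verts.apply_symm_apply _
  have hp : ∀ q, c'.marked (p q) = c.marked q := fun q => c'.marked.apply_symm_apply _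
  have hpσ : ∀ i s, (p (i, s)).1 = σ i := fun i s => c'.verts.injective (by
    rw [← c'.vert_marked, hp, c.vert_marked, hσ])
  have hg : ∀ j, Function.Bijective fun s => (p (σ.symm j, s)).2 := fun j =>
    Finite.injective_iff_bijective.1 fun s t hst => congrArg Prod.snd
      (p.injective (Prod.ext ((hpσ _ s).trans (hpσ _ t).symm) hst))
  let d : Wreath (Equiv.Perm (Fin 2)) k := ⟨fun j => Equiv.ofBijective _ (hg j), σ⟩
  have hd : ∀ q, wreathPerm k d q = p q := by
    rintro ⟨i, s⟩
    refine Prod.ext (hpσ i s).symm ?_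
    exact congrArg (fun j => (p (j, s)).2) (σ.symm_apply_apply i)
  refine ⟨d, mem_dihedral_iff.2 fun q => c'.marked.injective (Subtype.ext ?_),
    Subtype.ext (funext fun a => c'.verts.injective ?_), hσ, fun q => by rw [hd, hp]⟩
  -- Both enumerations intertwine `joinPerm` with the involution of the graph, so `d` commutes with
  -- `joinPerm`.
  · rw [hd, hd, hp, ← c'.inv_marked, hp, c.inv_marked]
  · exact (hσ _).trans ((c.vert_leg a).symm.trans (c'.vert_leg a))

/-- Different presentations differ by a dihedral element, which an invariant family `γ` does not
see. Such a family thus gives a map that depends only on the graph. -/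
theorem inv_map_comp_eq {n k : ℕ} {f f' : Surj n k} {Γ : StableGraph 1 n}
    (c : CyclicGluing f.1 Γ) (c' : CyclicGluing f'.1 Γ) (h : ∀ v, Γ.genus v = 0) {T : E}
    (γ : ∀ f : Surj n k, ((V.a 0).restrict 2).blockTensor f ⟶ T)
    (hγ : ∀ f, ∀ d ∈ dihedral k,
      ((V.a 0).restrict 2).blockMap (d, 1) f ≫ γ (f.act d.right 1) = γ f) :
    inv (c.map V h) ≫ γ f = inv (c'.map V h) ≫ γ f' := by
  obtain ⟨d, hd, rfl, hσ, hp⟩ := c.exists_mem_dihedral c'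
  have key : ((V.a 0).restrict 2).blockMap (d, 1) f ≫ c'.map V h = c.map V h := by
    refine (V.blockMap_flagMap h (d, 1) c'.verts c'.flags).trans
      (V.flagMap_congr h hσ fun i y => ?_)
    rcases y with s | a
    · exact hp (i, s)
    · exact (c'.flags_inr _ _).trans (c.flags_inr _ _).symm
  rw [← hγ f d hd, IsIso.inv_comp_eq, ← key, Category.assoc, IsIso.hom_inv_id_assoc]

end CyclicGluing


/-! ### Necklaces are cycles -/

/-- Cancelling the outermost `o` and `ι` from such an equation yields the same equation for `o (ι
x)`, with exponent smaller by two. In the end it would give a fixed point of `o` or of `ι`.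
Geometrically, a walk along a cycle never comes back in the opposite direction. -/
theorem alternating_iterate_ne {H : Type} (ι o : H → H) (ho : ∀ x, o (o x) = x)
    (hι : ∀ x, ι (ι x) = x) (hι' : ∀ x, ι x ≠ x) (ho' : ∀ x, o x ≠ x) (j : ℕ) (x : H) :
    (fun y => o (ι y))^[j] x ≠ o x := by
  induction j using Nat.twoStepInduction generalizing x with
  | zero => exact (ho' x).symm
  | one => exact fun h => hι' x ((ho _).symm.trans ((congrArg o h).trans (ho x)))
  | more j ih _ =>
    intro h
    rw [Function.iterate_succ_apply'] at h
    have h' := (ho _).symm.trans ((congrArg o h).trans (ho x))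
    have h'' := (hι _).symm.trans (congrArg ι h')
    rw [Function.iterate_succ_apply] at h''
    exact ih (o (ι x)) (h''.trans (ho _).symm)

namespace Graph
variable {F V : Type} {Γ : Graph F V}

/-- The predicate descends to components. Closure in one direction suffices because the involution
reverses every edge. -/
theorem Connected.induction (h : Γ.Connected) {S : V → Prop}
    (hS : ∀ x, S (Γ.vert x) → S (Γ.vert (Γ.inv x))) {v : V} (hv : S v) (w : V) : S w := by
  have hsub : Subsingleton Γ.Components := (Nat.card_eq_one_iff_unique.1 h).1
  let S' : Γ.Components → Prop := Quot.lift S fun a b ⟨x, ha, hb⟩ => propext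
    ⟨fun h => hb ▸ hS x (ha.symm ▸ h), fun h => by
      have := hS (Γ.inv x) (hb.symm ▸ h)
      rwa [Γ.inv_inv, ha] at this⟩
  have : S' (Quot.mk _ w) = S' (Quot.mk _ v) :=
    congrArg S' (hsub.elim (Quot.mk _ w : Γ.Components) (Quot.mk _ v))
  exact (Eq.symm this).mp hv

theorem Connected.nonempty (h : Γ.Connected) : Nonempty V :=
  have : Nonempty Γ.Components := (Nat.card_eq_one_iff_unique.1 h).2
  this.elim fun x => Quot.inductionOn x fun v => ⟨v⟩

theorem connected_of_path {m : ℕ} (e : Fin (m + 1) ≃ V)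
    (h : ∀ i : Fin m, ∃ x, Γ.vert x = e i.castSucc ∧ Γ.vert (Γ.inv x) = e i.succ) :
    Γ.Connected := by
  have key : ∀ i, (Quot.mk _ (e i) : Γ.Components) = Quot.mk _ (e 0) := by
    intro i
    induction i using Fin.induction with
    | zero => rfl
    | succ i ih => exact (Quot.sound (h i)).symm.trans ih
  refine Nat.card_eq_one_iff_unique.2 ⟨⟨fun a b => ?_⟩, ⟨Quot.mk _ (e 0)⟩⟩
  obtain ⟨v, rfl⟩ := Quot.exists_rep a
  obtain ⟨w, rfl⟩ := Quot.exists_rep b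
  obtain ⟨i, rfl⟩ := e.surjective v
  obtain ⟨j, rfl⟩ := e.surjective w
  exact (key i).trans (key j).symm

theorem connected_of_marked {k : ℕ} (hk : 0 < k) (e : Fin k ≃ V)
    (N : Fin k × Fin 2 ≃ {x // Γ.inv x ≠ x}) (hv : ∀ p, Γ.vert (N p).1 = e p.1)
    (hN : ∀ p, Γ.inv (N p).1 = (N (joinPerm k p)).1) : Γ.Connected := by
  obtain ⟨m, rfl⟩ := Nat.exists_eq_succ_of_ne_zero hk.ne'
  refine connected_of_path e fun i => ⟨(N (i.castSucc, 1)).1, hv _, ?_⟩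
  rw [hN, hv]
  simp

theorem b1_of_marked {k : ℕ} (hk : 0 < k) (e : Fin k ≃ V)
    (N : Fin k × Fin 2 ≃ {x // Γ.inv x ≠ x}) (hv : ∀ p, Γ.vert (N p).1 = e p.1)
    (hN : ∀ p, Γ.inv (N p).1 = (N (joinPerm k p)).1) : Γ.b1 = 1 := by
  have h1 : Nat.card Γ.Components = 1 := connected_of_marked hk e N hv hN
  have h2 : Γ.numEdges = k := by
    rw [numEdges, ← Nat.card_congr N]
    simp
  rw [b1, h1, h2, ← Nat.card_congr e]
  simp

theorem isNecklace_of_marked {k : ℕ} (hk : 0 < k) (e : Fin k ≃ V)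
    (N : Fin k × Fin 2 ≃ {x // Γ.inv x ≠ x}) (hv : ∀ p, Γ.vert (N p).1 = e p.1)
    (hN : ∀ p, Γ.inv (N p).1 = (N (joinPerm k p)).1) : Γ.IsNecklace := by
  refine ⟨connected_of_marked hk e N hv hN, b1_of_marked hk e N hv hN, fun x hx => ?_⟩
  obtain ⟨p, hp⟩ := N.surjective ⟨x, hx⟩
  obtain rfl : (N p).1 = x := congrArg Subtype.val hp
  obtain ⟨m, rfl⟩ := Nat.exists_eq_succ_of_ne_zero hk.ne'
  -- Every edge contains exactly one second marked flag, and `i₀` is the vertex carrying that of the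
  -- removed edge.
  have key : ∃ i₀, ∀ i, i ≠ i₀ → (i, 1) ≠ p ∧ (i, 1) ≠ joinPerm _ p := by
    obtain ⟨j, s⟩ := p
    fin_cases s
    · exact ⟨(finRotate _).symm j, fun i hi => ⟨by simp, fun h => hi (congrArg Prod.fst h)⟩⟩
    · exact ⟨j, fun i hi => ⟨fun h => hi (congrArg Prod.fst h), by simp⟩⟩
  obtain ⟨i₀, hi₀⟩ := key
  -- The path that starts just after `i₀` and goes once around to `i₀` avoids the removed edge.
  refine connected_of_path ((Equiv.addRight (i₀ + 1)).trans e) fun i => ?_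
  have hi : i.castSucc + (i₀ + 1) ≠ i₀ := by
    rw [add_comm i₀, ← add_assoc, Ne, add_eq_right, Fin.coeSucc_eq_succ]
    exact Fin.succ_ne_zero i
  obtain ⟨h1, h2⟩ := hi₀ _ hi
  refine ⟨⟨(N (i.castSucc + (i₀ + 1), 1)).1, fun h => h1 (N.injective (Subtype.ext h)),
    fun h => h2 (N.injective (Subtype.ext (h.trans (hN p))))⟩, hv _, ?_⟩
  refine (congrArg Γ.vert (hN _)).trans ((hv _).trans (congrArg e ?_))
  simp only [joinPerm_one, finRotate_apply, Equiv.coe_addRight, ← Fin.coeSucc_eq_succ]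
  exact add_right_comm _ _ _

/-- The involution on the flags that are not legs. -/
def invMarked (x : {x // Γ.inv x ≠ x}) : {x // Γ.inv x ≠ x} :=
  ⟨Γ.inv x.1, fun h => x.2 (Γ.inv_injective h)⟩

/-- Needed because `numEdges` is defined by a truncating division. -/
theorem even_card_marked [Finite F] : 2 ∣ Nat.card {x // Γ.inv x ≠ x} := by
  classical
  have := Fintype.ofFinite F
  have hinv : Function.Involutive Γ.inv := Γ.inv_inv
  have h := Equiv.Perm.two_dvd_card_support (σ := hinv.toPerm)
    (Equiv.ext fun x => by simp [sq, hinv x])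
  rw [Nat.card_eq_fintype_card, Fintype.card_subtype]
  exact h

/-- With one component and Betti number one, the Euler characteristic gives as many edges as
vertices. -/
theorem IsNecklace.card_marked [Finite F] (h : Γ.IsNecklace) :
    Nat.card {x // Γ.inv x ≠ x} = 2 * Nat.card V := by
  obtain ⟨m, hm⟩ := Γ.even_card_marked
  have h1 := h.2.1
  have h2 : Nat.card Γ.Components = 1 := h.1
  rw [b1, numEdges, h2, hm] at h1
  omega

section Finite
variable [Finite F] [Finite V]

/-- If a vertex had a single edge flag, removing that edge would isolate it. If it had none, it
would be the only vertex by connectedness, and there would be no edges, contradicting the equality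
of the numbers of edges and vertices. -/
theorem IsNecklace.two_le_card_marked (h : Γ.IsNecklace) (v : V) :
    2 ≤ Nat.card {x : {x // Γ.inv x ≠ x} // Γ.vert x.1 = v} := by
  by_contra! hlt
  have hsub : Subsingleton {x : {x // Γ.inv x ≠ x} // Γ.vert x.1 = v} :=
    Finite.card_le_one_iff_subsingleton.1 (by omega)
  by_cases hne : ∃ x, Γ.inv x ≠ x ∧ Γ.vert x = v
  · obtain ⟨x, hx, rfl⟩ := hne
    have hx' : Γ.vert (Γ.inv x) ≠ Γ.vert x := fun hx' => hx <|
      congrArg (fun y => y.1.1) (hsub.elim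
        ⟨⟨Γ.inv x, fun h => hx (Γ.inv_injective h)⟩, hx'⟩ ⟨⟨x, hx⟩, rfl⟩)
    -- Once the edge is removed, only legs remain at this vertex, so its component is the vertex
    -- alone and cannot contain the other end.
    refine hx' ((h.2.2 x hx).induction (S := (· = Γ.vert x)) (fun y hy => ?_) rfl _)
    have hy' : Γ.inv y.1 = y.1 := by
      by_contra hne
      exact y.2.1 (congrArg (fun y => y.1.1) (hsub.elim ⟨⟨y.1, hne⟩, hy⟩ ⟨⟨x, hx⟩, rfl⟩))
    exact (congrArg Γ.vert hy').trans hy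
  · push Not at hne
    have hall : ∀ w, w = v := h.1.induction (S := (· = v)) (fun y hy => by
      by_contra hy'
      exact hne y (fun h => hy' (h.symm ▸ hy)) hy) rfl
    have h1 := h.card_marked
    have : IsEmpty {x // Γ.inv x ≠ x} := ⟨fun x => hne x.1 x.2 (hall _)⟩
    have : Nonempty V := ⟨v⟩
    have h2 : 0 < Nat.card V := Nat.card_pos
    rw [Nat.card_of_isEmpty] at h1
    omega

/-- The average number of edge flags per vertex is two and each vertex has at least two, so equality
holds everywhere. -/
theorem IsNecklace.card_marked_vert (h : Γ.IsNecklace) (v : V) :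
    Nat.card {x : {x // Γ.inv x ≠ x} // Γ.vert x.1 = v} = 2 := by
  have := Fintype.ofFinite V
  have h1 := h.card_marked
  rw [← Nat.card_congr (Equiv.sigmaFiberEquiv fun x : {x // Γ.inv x ≠ x} => Γ.vert x.1),
    Nat.card_sigma, Nat.card_eq_fintype_card] at h1
  have h2 : ∑ _v : V, 2 = ∑ v, Nat.card {x : {x // Γ.inv x ≠ x} // Γ.vert x.1 = v} := by
    rw [h1, Finset.sum_const, Finset.card_univ, smul_eq_mul, mul_comm]
  exact ((Finset.sum_eq_sum_iff_of_le fun v _ => h.two_le_card_marked v).1 h2 v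
    (Finset.mem_univ v)).symm

/-- The vertices of a necklace and the flags that are not legs can be enumerated in cyclic order. -/
theorem IsNecklace.exists_marked (h : Γ.IsNecklace) :
    ∃ (k : ℕ) (_ : 0 < k) (e : Fin k ≃ V) (N : Fin k × Fin 2 ≃ {x // Γ.inv x ≠ x}),
      (∀ p, Γ.vert (N p).1 = e p.1) ∧ ∀ p, Γ.inv (N p).1 = (N (joinPerm k p)).1 := by
  let H := {x // Γ.inv x ≠ x}
  let ι : H → H := Γ.invMarked
  have hι : ∀ x, ι (ι x) = x := fun x => Subtype.ext (Γ.inv_inv x.1)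
  have hι' : ∀ x, ι x ≠ x := fun x hx => x.2 (congrArg Subtype.val hx)
  -- The second involution `o` exchanges the two edge flags at a vertex.
  have hother : ∀ x : H, ∃ y : H, Γ.vert y.1 = Γ.vert x.1 ∧ y ≠ x ∧
      ∀ z : H, Γ.vert z.1 = Γ.vert x.1 → z = x ∨ z = y := by
    intro x
    obtain ⟨y, hy, hy'⟩ := (Nat.card_eq_two_iff'
      (⟨x, rfl⟩ : {y : H // Γ.vert y.1 = Γ.vert x.1})).1 (h.card_marked_vert _)
    refine ⟨y.1, y.2, fun hxy => hy (Subtype.ext hxy), fun z hz => or_iff_not_imp_left.2 fun hzx =>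
      congrArg Subtype.val (hy' ⟨z, hz⟩ fun hzx' => hzx (congrArg Subtype.val hzx'))⟩
  choose o hov hon hoz using hother
  have ho : ∀ x, o (o x) = x := fun x =>
    ((hoz (o x) x (hov x).symm).resolve_left (hon x).symm).symm
  obtain ⟨v₀⟩ := h.1.nonempty
  obtain ⟨⟨x₀, -⟩⟩ : Nonempty {x : H // Γ.vert x.1 = v₀} :=
    (Nat.card_pos_iff.1 (by rw [h.card_marked_vert v₀]; norm_num)).1
  -- One step of the walk: cross the edge, then pass to the other edge flag of the vertex reached.
  let T : H → H := fun y => o (ι y)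
  have hT : Function.Injective T := (Function.LeftInverse.injective ho).comp
    (Function.LeftInverse.injective hι)
  have hoT : ∀ j x, T^[j] x ≠ o x := alternating_iterate_ne ι o ho hι hι' hon
  let k := Function.minimalPeriod T x₀
  have hk : 0 < k := Function.minimalPeriod_pos_of_mem_periodicPts
    (hT.mem_periodicPts x₀)
  -- If the walk returns to a vertex, it does so at the same flag: the other flag would mean a
  -- reversal of direction, which `hoT` excludes.
  have hT' : ∀ i j, Γ.vert (T^[i] x₀).1 = Γ.vert (T^[j] x₀).1 → T^[i] x₀ = T^[j] x₀ := by
    have aux : ∀ i j, i ≤ j → T^[j] x₀ ≠ o (T^[i] x₀) := by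
      intro i j hij
      obtain ⟨l, rfl⟩ := Nat.exists_eq_add_of_le' hij
      rw [Function.iterate_add_apply]
      exact hoT l _
    intro i j hij
    refine (hoz _ _ hij).resolve_right fun h => ?_
    rcases le_total i j with h' | h'
    · exact aux i j h' (by rw [h, ho])
    · exact aux j i h' h
  -- The visited vertices are closed under adjacency. From the flag `T^[i] x₀` the edge leads to the
  -- next vertex of the walk, and from the other flag to the preceding one.
  have hsurj : ∀ w, ∃ i, Γ.vert (T^[i] x₀).1 = w := by
    refine h.1.induction (fun x hx => ?_) (v := Γ.vert x₀.1) ⟨0, rfl⟩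
    obtain ⟨i, hi⟩ := hx
    by_cases hl : Γ.inv x = x
    · exact ⟨i, hi.trans (congrArg Γ.vert hl.symm)⟩
    rcases hoz (T^[i] x₀) ⟨x, hl⟩ hi.symm with hx | hx
    · refine ⟨i + 1, ?_⟩
      rw [Function.iterate_succ_apply', ← hx]
      exact hov _
    -- The index `i + k - 1` stands for `i - 1` modulo the period, as `i` may be zero.
    · have hper : T^[i] x₀ = T (T^[i + k - 1] x₀) := by
        rw [← Function.iterate_succ_apply' T, Nat.succ_eq_add_one, Nat.sub_add_cancel (by omega),
          Function.iterate_add_apply, Function.iterate_minimalPeriod]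
      refine ⟨i + k - 1, ?_⟩
      have h1 : ι ⟨x, hl⟩ = T^[i + k - 1] x₀ := by rw [hx, hper, ho, hι]
      rw [← h1]
      rfl
  let e : Fin k ≃ V := Equiv.ofBijective (fun i => Γ.vert (T^[i] x₀).1)
    ⟨fun i j hij => Fin.ext (Function.iterate_injOn_Iio_minimalPeriod i.2 j.2 (hT' i j hij)),
      fun w => by
        obtain ⟨i, rfl⟩ := hsurj w
        refine ⟨⟨i % k, Nat.mod_lt _ hk⟩, ?_⟩
        simp only
        rw [Function.iterate_mod_minimalPeriod_eq]⟩
  -- The second marked flag is the one by which the walk leaves the vertex, the first the one by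
  -- which it arrives.
  let N₀ : Fin k × Fin 2 → H := fun p => if p.2 = 0 then o (T^[p.1] x₀) else T^[p.1] x₀
  have hv : ∀ p, Γ.vert (N₀ p).1 = e p.1 := by
    rintro ⟨i, s⟩
    fin_cases s
    · exact hov _
    · rfl
  have hN₀ : Function.Bijective N₀ := by
    constructor
    · rintro ⟨i, s⟩ ⟨j, t⟩ hij
      obtain rfl : i = j := e.injective (by rw [← hv (i, s), hij, hv])
      fin_cases s <;> fin_cases t
      · rfl
      · exact absurd hij (hon _)
      · exact absurd hij.symm (hon _)
      · rfl
    · intro x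
      obtain ⟨i, hi⟩ := e.surjective (Γ.vert x.1)
      rcases hoz (T^[i] x₀) x hi.symm with hx | hx
      · exact ⟨(i, 1), hx.symm⟩
      · exact ⟨(i, 0), hx.symm⟩
  have hstep : ∀ i, ι (N₀ (i, 1)) = N₀ (finRotate k i, 0) := by
    intro i
    have h1 : ((finRotate k i : Fin k) : ℕ) = (i + 1) % k := by
      rw [finRotate_apply, Fin.val_add, Fin.val_one', Nat.add_mod_mod]
    change ι (T^[i] x₀) = o (T^[finRotate k i] x₀)
    rw [h1, Function.iterate_mod_minimalPeriod_eq, Function.iterate_succ_apply', ho]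
  have hN : ∀ p, ι (N₀ p) = N₀ (joinPerm k p) := by
    rintro ⟨i, s⟩
    fin_cases s
    · have := hstep ((finRotate k).symm i)
      rw [Equiv.apply_symm_apply] at this
      exact (congrArg ι this.symm).trans (hι _)
    · exact hstep i
  exact ⟨k, hk, e, Equiv.ofBijective N₀ hN₀, hv, fun p => congrArg Subtype.val (hN p)⟩

end Finite

end Graph

/-- Every necklace of genus-zero vertices is obtained by cyclic gluing. -/
theorem exists_cyclicGluing {n : ℕ} (Γ : (GraphClass.necklaces n).Objects) :
    ∃ (k : Fin (n + 1)) (f : Surj n k), Nonempty (CyclicGluing f.1 Γ.1) := by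
  obtain ⟨Γ, h, h0⟩ := Γ
  obtain ⟨k, hk, e, N, hv, hN⟩ := h.exists_marked
  let f : Fin n → Fin k := fun a => e.symm (Γ.graph.vert (Γ.leg a).1)
  -- A genus-zero vertex without legs would have only its two edge flags, contrary to stability.
  have hf : Function.Surjective f := by
    intro i
    by_contra! hi
    have hnl : ∀ x : Γ.graph.FlagsAt (e i), Γ.graph.inv x.1 ≠ x.1 := by
      intro x hx
      obtain ⟨a, ha⟩ := Γ.leg.surjective ⟨x.1, hx⟩
      refine hi a (e.injective ?_)
      rw [Equiv.apply_symm_apply, ha, x.2]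
    have h1 := Γ.stable (e i)
    rw [h0] at h1
    have h2 := h.card_marked_vert (e i)
    have h3 : Γ.graph.FlagsAt (e i) ≃
        {x : {x // Γ.graph.inv x ≠ x} // Γ.graph.vert x.1 = e i} :=
      ⟨fun x => ⟨⟨x.1, hnl x⟩, x.2⟩, fun x => ⟨x.1.1, x.2⟩, fun _ => rfl, fun _ => rfl⟩
    rw [Nat.card_congr h3] at h1
    omega
  have hkn : k ≤ n := by simpa using Fintype.card_le_of_surjective f hf
  exact ⟨⟨k, Nat.lt_succ_of_le hkn⟩, ⟨f, hf⟩,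
    CyclicGluing.nonempty_of_marked e N hv hN fun a => (e.apply_symm_apply _).symm⟩

/-- Every ordered decomposition of the labels gives rise to a necklace by cyclic gluing. -/
theorem exists_necklace {n k : ℕ} (hn : 0 < n) (f : Surj n k) :
    ∃ Γ : (GraphClass.necklaces n).Objects, Nonempty (CyclicGluing f.1 Γ.1) := by
  have hk : 0 < k := (f.1 ⟨0, hn⟩).pos
  let ε : (Fin k × Fin 2) ⊕ Fin n ≃ Fin (k * 2 + n) :=
    (Equiv.sumCongr finProdFinEquiv (Equiv.refl _)).trans finSumFinEquiv
  let G : Graph (Fin (k * 2 + n)) (Fin k) :=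
    { vert x := Sum.elim Prod.fst f.1 (ε.symm x)
      inv x := ε (Sum.map (joinPerm k) id (ε.symm x))
      inv_inv x := by
        obtain ⟨x, rfl⟩ := ε.surjective x
        rcases x with p | a
        · simp only [Equiv.symm_apply_apply, Sum.map_inl, joinPerm_joinPerm]
        · simp only [Equiv.symm_apply_apply, Sum.map_inr, id] }
  have hvl : ∀ p, G.vert (ε (.inl p)) = p.1 := fun p => by
    simp only [G, Equiv.symm_apply_apply, Sum.elim_inl]
  have hvr : ∀ a, G.vert (ε (.inr a)) = f.1 a := fun a => by
    simp only [G, Equiv.symm_apply_apply, Sum.elim_inr]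
  have hil : ∀ p, G.inv (ε (.inl p)) = ε (.inl (joinPerm k p)) := fun p => by
    simp only [G, Equiv.symm_apply_apply, Sum.map_inl]
  have hir : ∀ a, G.inv (ε (.inr a)) = ε (.inr a) := fun a => by
    simp only [G, Equiv.symm_apply_apply, Sum.map_inr, id]
  have hil' : ∀ p, G.inv (ε (.inl p)) ≠ ε (.inl p) := fun p h => by
    rw [hil] at h
    exact joinPerm_snd_ne p (congrArg Prod.snd (Sum.inl_injective (ε.injective h)))
  let N : Fin k × Fin 2 ≃ {x // G.inv x ≠ x} :=
    Equiv.ofBijective (fun p => ⟨ε (.inl p), hil' p⟩)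
      ⟨fun p q h => Sum.inl_injective (ε.injective (congrArg Subtype.val h)), fun ⟨x, hx⟩ => by
        obtain ⟨x | a, rfl⟩ := ε.surjective x
        · exact ⟨x, rfl⟩
        · exact absurd (hir a) hx⟩
  let ℓ : Fin n ≃ G.Legs :=
    Equiv.ofBijective (fun a => ⟨ε (.inr a), hir a⟩)
      ⟨fun p q h => Sum.inr_injective (ε.injective (congrArg Subtype.val h)), fun ⟨x, hx⟩ => by
        obtain ⟨x | a, rfl⟩ := ε.surjective x
        · exact absurd hx (hil' x)
        · exact ⟨a, rfl⟩⟩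
  have hG : G.IsNecklace := Graph.isNecklace_of_marked hk (Equiv.refl _) N hvl hil
  let Γ : StableGraph 1 n :=
    { numFlags := k * 2 + n
      numVerts := k
      graph := G
      genus _ := 0
      leg := ℓ
      connected := hG.1
      -- Two marked flags and at least one leg, by surjectivity of `f`.
      stable v := by
        obtain ⟨a, rfl⟩ := f.2 v
        have hinj : Function.Injective (Sum.elim
            (fun s : Fin 2 => (⟨ε (.inl (f.1 a, s)), hvl _⟩ : G.FlagsAt (f.1 a)))
            (fun _ : Unit => ⟨ε (.inr a), hvr a⟩)) := by
          rintro (s | s) (t | t) h <;> have h' := ε.injective (congrArg Subtype.val h)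
          · cases h'; rfl
          · cases h'
          · cases h'
          · rfl
        have := Nat.card_le_card_of_injective _ hinj
        rw [Nat.card_sum, Nat.card_fin, Nat.card_unique] at this
        change 2 + 1 ≤ Nat.card (G.FlagsAt (f.1 a)) at this
        omega
      total_genus := by simpa using hG.2.1 }
  exact ⟨⟨Γ, hG, fun _ => rfl⟩,
    CyclicGluing.nonempty_of_marked (Γ := Γ) (Equiv.refl _) N hvl hil hvr⟩


/-! ### The necklaces as a direct summand -/

section SplitMono

/-- The cyclic enumeration of vertices and edge flags is transported along the isomorphism, and it
characterizes necklaces. -/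
theorem StableGraph.Hom.isNecklace {n : ℕ} {Γ Δ : StableGraph 1 n} (φ : Γ ⟶ Δ)
    (h : (GraphClass.necklaces n).prop Γ) : (GraphClass.necklaces n).prop Δ := by
  obtain ⟨k, hk, e, N, hv, hN⟩ := h.1.exists_marked
  let φ' : StableGraph.Hom Γ Δ := φ
  have hm : ∀ x, Γ.graph.inv x ≠ x ↔ Δ.graph.inv (φ'.flags x) ≠ φ'.flags x := fun x => by
    rw [φ'.inv_flags, Ne, Ne, φ'.flags.injective.eq_iff]
  refine ⟨Graph.isNecklace_of_marked hk (e.trans φ'.verts) (N.trans (φ'.flags.subtypeEquiv hm))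
    (fun p => ?_) (fun p => ?_), fun v => ?_⟩
  · exact (φ'.vert_flags _).trans (congrArg φ'.verts (hv p))
  · exact (φ'.inv_flags _).trans (congrArg φ'.flags (hN p))
  · obtain ⟨v, rfl⟩ := φ'.verts.surjective v
    rw [φ'.genus_verts, h.2]

variable {E : Type u} [Category.{v} E] [Preadditive E] [MonoidalCategory E] [SymmetricCategory E]
  [HasFiniteColimits E] (V : StableSModule E)

namespace StableSModule

open Classical in
/-- The components of the retraction onto the necklaces, zero on all other graphs. -/
noncomputable def necklaceRetractionMk {n : ℕ} (Γ : StableGraph 1 n) :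
    V.graphObj Γ ⟶ colimit (V.graphFunctor (.necklaces n)) :=
  if h : (GraphClass.necklaces n).prop Γ then V.graphSumMk (.necklaces n) ⟨Γ, h⟩ else 0

/-- No isomorphism connects a necklace of genus-zero vertices with any other graph, so extension by
zero is compatible with isomorphisms. -/
theorem necklaceRetractionMk_naturality {n : ℕ} {Γ Δ : StableGraph 1 n} (φ : Γ ⟶ Δ) :
    V.graphMap φ ≫ V.necklaceRetractionMk Δ = V.necklaceRetractionMk Γ := by
  by_cases h : (GraphClass.necklaces n).prop Γ
  · have h' := StableGraph.Hom.isNecklace φ h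
    rw [necklaceRetractionMk, necklaceRetractionMk, dif_pos h, dif_pos h']
    exact V.graphSumMk_naturality (.necklaces n) (Γ := ⟨Γ, h⟩) (Δ := ⟨Δ, h'⟩) φ
  · have h' : ¬ (GraphClass.necklaces n).prop Δ := fun h' => by
      let φ' : StableGraph.Hom Γ Δ := φ
      have ψ : StableGraph.Hom Δ Γ :=
        { flags := φ'.flags.symm
          verts := φ'.verts.symm
          vert_flags x := by
            obtain ⟨x, rfl⟩ := φ'.flags.surjective x
            simp [φ'.vert_flags]
          inv_flags x := by
            obtain ⟨x, rfl⟩ := φ'.flags.surjective x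
            simp [φ'.inv_flags]
          genus_verts v := by
            obtain ⟨v, rfl⟩ := φ'.verts.surjective v
            simp [φ'.genus_verts]
          flags_leg a := by simp [← φ'.flags_leg] }
      exact h (StableGraph.Hom.isNecklace ψ h')
    rw [necklaceRetractionMk, necklaceRetractionMk, dif_neg h, dif_neg h', comp_zero]

theorem necklaceRetractionMk_act {n : ℕ} (σ : Equiv.Perm (Fin n)) (Γ : StableGraph 1 n) :
    V.necklaceRetractionMk Γ ≫ V.graphSumAct (.necklaces n) σ =
      V.necklaceRetractionMk (Γ.relabel σ) := by
  by_cases h : (GraphClass.necklaces n).prop Γ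
  · have h' : (GraphClass.necklaces n).prop (Γ.relabel σ) := h
    rw [necklaceRetractionMk, necklaceRetractionMk, dif_pos h, dif_pos h']
    exact V.graphSumMk_act _ _ _
  · have h' : ¬ (GraphClass.necklaces n).prop (Γ.relabel σ) := h
    rw [necklaceRetractionMk, necklaceRetractionMk, dif_neg h, dif_neg h', zero_comp]
    rfl

/-- The retraction of the sum over all stable graphs of genus one onto the sum over necklaces. -/
noncomputable def necklaceRetractionHom (n : ℕ) :
    colimit (V.graphFunctor (.all 1 n)) ⟶ colimit (V.graphFunctor (.necklaces n)) :=
  colimit.desc (V.graphFunctor (.all 1 n))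
    { pt := _
      ι :=
        { app Γ := V.necklaceRetractionMk Γ.1
          naturality _ _ φ :=
            (V.necklaceRetractionMk_naturality φ).trans (Category.comp_id _).symm } }

theorem graphSumMk_necklaceRetractionHom (n : ℕ) (Γ : (GraphClass.all 1 n).Objects) :
    V.graphSumMk (.all 1 n) Γ ≫ V.necklaceRetractionHom n = V.necklaceRetractionMk Γ.1 :=
  colimit.ι_desc _ _

/-- The retraction onto the sum over necklaces, as a map of representations. -/
noncomputable def necklaceRetraction (n : ℕ+) : V.b 1 n ⟶ V.necklaceModule n where
  hom := V.necklaceRetractionHom n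
  comm σ := colimit.hom_ext fun Γ => by
    refine (Category.assoc _ _ _).symm.trans ?_
    refine (congrArg (· ≫ V.necklaceRetractionHom n)
      (V.graphSumMk_act (.all 1 n) σ Γ)).trans ?_
    refine (V.graphSumMk_necklaceRetractionHom n _).trans ?_
    refine Eq.trans ?_ (Category.assoc _ _ _)
    refine Eq.trans ?_ (congrArg (· ≫ V.graphSumAct (.necklaces n) σ)
      (V.graphSumMk_necklaceRetractionHom n Γ).symm)
    exact (V.necklaceRetractionMk_act σ Γ.1).symm

theorem isSplitMono_necklaceInclusion (n : ℕ+) : IsSplitMono (V.necklaceInclusion n) := by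
  refine IsSplitMono.mk' ⟨V.necklaceRetraction n, Action.Hom.ext (colimit.hom_ext fun Γ => ?_)⟩
  refine (Category.assoc _ _ _).symm.trans ?_
  refine (congrArg (· ≫ V.necklaceRetractionHom n)
    (V.graphSumMk_necklaceInclusionHom n Γ)).trans ?_
  refine (V.graphSumMk_necklaceRetractionHom n _).trans ?_
  exact (dif_pos Γ.2).trans (Category.comp_id _).symm

end StableSModule

end SplitMono

/-! ### Independence of the choices in the colimit and in the plethysm -/

namespace CyclicGluing
variable {E : Type u} [Category.{v} E] [MonoidalCategory E] [SymmetricCategory E]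
  [HasFiniteColimits E] (V : StableSModule E)

/-- Graphs glued from the same `f` are isomorphic compatibly with the gluing maps, and isomorphisms
become identities in the colimit. -/
theorem map_graphSumMk_eq {n k : ℕ} {f : Surj n k} {Γ Δ : (GraphClass.necklaces n).Objects}
    (c : CyclicGluing f.1 Γ.1) (c' : CyclicGluing f.1 Δ.1) :
    c.map V Γ.2.2 ≫ V.graphSumMk (.necklaces n) Γ =
      c'.map V Δ.2.2 ≫ V.graphSumMk (.necklaces n) Δ := by
  obtain ⟨φ, hφ⟩ := c.exists_iso V c' Γ.2.2 Δ.2.2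
  rw [← hφ, Category.assoc]
  exact congrArg (_ ≫ ·) (V.graphSumMk_naturality (.necklaces n) (Γ := Γ) (Δ := Δ) φ).symm

/-- With `x.2 = 1` this is the dihedral invariance, with `x.1 = 1` the equivariance, that the
universal property of the plethysm asks for. -/
theorem blockMap_map_graphSumMk {n k : ℕ} {f : Surj n k}
    (x : Wreath (Equiv.Perm (Fin 2)) k × Equiv.Perm (Fin n)) (hx : x.1 ∈ dihedral k)
    {Γ Δ : (GraphClass.necklaces n).Objects} (c : CyclicGluing f.1 Γ.1)
    (c' : CyclicGluing (f.act x.1.right x.2).1 Δ.1) :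
    ((V.a 0).restrict 2).blockMap x f ≫ c'.map V Δ.2.2 ≫ V.graphSumMk (.necklaces n) Δ =
      (c.map V Γ.2.2 ≫ V.graphSumMk (.necklaces n) Γ) ≫ V.graphSumAct (.necklaces n) x.2 := by
  obtain ⟨c'', hc⟩ := c.exists_act V Γ.2.2 x hx
  refine (congrArg (_ ≫ ·) (map_graphSumMk_eq V c'
    (Δ := (GraphClass.necklaces n).relabelObj x.2 Γ) c'')).trans ?_
  refine (Category.assoc _ _ _).symm.trans ((congrArg (· ≫ _) hc).trans ?_)
  refine Eq.trans ?_ (Category.assoc _ _ _).symm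
  exact congrArg (_ ≫ ·) (V.graphSumMk_act _ x.2 Γ).symm

theorem inv_map_dihClass_eq {n : ℕ+} {k k' : Fin (n + 1)} {f : Surj n k} {f' : Surj n k'}
    {Γ : StableGraph 1 n} (h : ∀ v, Γ.genus v = 0) (c : CyclicGluing f.1 Γ)
    (c' : CyclicGluing f'.1 Γ) :
    inv (c.map V h) ≫ dihClass ((V.a 0).restrict 2) f =
      inv (c'.map V h) ≫ dihClass ((V.a 0).restrict 2) f' := by
  -- Both numbers count the vertices of the graph.
  obtain rfl : k = k' := Fin.ext (Fin.equiv_iff_eq.1 ⟨c.verts.trans c'.verts.symm⟩)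
  exact c.inv_map_comp_eq V c' h (fun f => dihClass ((V.a 0).restrict 2) f)
    fun f d hd => blockMap_dihClass _ f hd

end CyclicGluing

/-! ### The isomorphism and its inverse -/

section Comparison
variable {E : Type u} [Category.{v} E] [MonoidalCategory E] [SymmetricCategory E]
  [HasFiniteColimits E] (V : StableSModule E)

/-- Gluing vertices with two marked legs in cyclic order defines a map from the plethysm. -/
theorem exists_plethysm_hom [Preadditive E] [MonoidalPreadditive E] (n : ℕ+) :
    ∃ Φ : plethysm (Dih E) ((V.a 0).restrict 2) n ⟶ V.necklaceModule n,
      ∀ (k : Fin (n + 1)) (f : Surj n k) (Γ : (GraphClass.necklaces n).Objects)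
        (c : CyclicGluing f.1 Γ.1), dihClass ((V.a 0).restrict 2) f ≫ Φ.hom =
          c.map V Γ.2.2 ≫ V.graphSumMk (.necklaces n) Γ := by
  -- An arbitrary graph and presentation for each decomposition; `map_graphSumMk_eq` shows that the
  -- choice does not matter.
  choose Γ hc using fun (k : Fin (n + 1)) (f : Surj n k) => exists_necklace n.pos f
  let c := fun k f => (hc k f).some
  obtain ⟨Φ, hΦ⟩ := exists_plethysm_desc ((V.a 0).restrict 2) (V.necklaceModule n)
    (fun k f => (c k f).map V (Γ k f).2.2 ≫ V.graphSumMk (.necklaces n) (Γ k f))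
    (fun k f d hd => by
      have h1 : V.graphSumAct (.necklaces n) 1 = 𝟙 _ := (V.necklaceModule n).ρ.map_one
      refine (CyclicGluing.blockMap_map_graphSumMk V (d, 1) hd (c k f)
        (c k (f.act d.right 1))).trans ?_
      rw [h1]
      exact Category.comp_id _)
    (fun k f τ => CyclicGluing.blockMap_map_graphSumMk V (1, τ) (one_mem _) (c k f)
      (c k (f.act 1 τ)))
  exact ⟨Φ, fun k f Δ c' => (hΦ k f).trans (CyclicGluing.map_graphSumMk_eq V (c k f) c')⟩

/-- Every necklace has a class in the plethysm, independent of its presentation. -/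
theorem exists_necklace_hom (n : ℕ+) :
    ∃ Ψ : V.necklaceModule n ⟶ plethysm (Dih E) ((V.a 0).restrict 2) n,
      ∀ (k : Fin (n + 1)) (f : Surj n k) (Γ : (GraphClass.necklaces n).Objects)
        (c : CyclicGluing f.1 Γ.1), V.graphSumMk (.necklaces n) Γ ≫ Ψ.hom =
          inv (c.map V Γ.2.2) ≫ dihClass ((V.a 0).restrict 2) f := by
  choose k f hc using fun Γ : (GraphClass.necklaces n).Objects => exists_cyclicGluing Γ
  let c := fun Γ => (hc Γ).some
  let δ : ∀ Γ : (GraphClass.necklaces n).Objects, V.graphObj Γ.1 ⟶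
      (plethysm (Dih E) ((V.a 0).restrict 2) n).V := fun Γ =>
    inv ((c Γ).map V Γ.2.2) ≫ dihClass ((V.a 0).restrict 2) (f Γ)
  -- Any presentation may replace the chosen one. Naturality and equivariance follow by using the
  -- transported or relabelled presentation.
  have hδ : ∀ (k : Fin (n + 1)) (f : Surj n k) (Γ : (GraphClass.necklaces n).Objects)
      (c : CyclicGluing f.1 Γ.1),
      δ Γ = inv (c.map V Γ.2.2) ≫ dihClass ((V.a 0).restrict 2) f := fun _ _ Γ c' =>
    CyclicGluing.inv_map_dihClass_eq V Γ.2.2 (c Γ) c'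
  have hnat : ∀ {Γ Δ : (GraphClass.necklaces n).Objects} (φ : Γ.1 ⟶ Δ.1),
      V.graphMap φ ≫ δ Δ = δ Γ := by
    intro Γ Δ φ
    obtain ⟨c', hc'⟩ := (c Γ).exists_transport V Γ.2.2 Δ.2.2 φ
    rw [hδ _ _ Δ c', hδ _ _ Γ (c Γ), IsIso.eq_inv_comp, reassoc_of% hc', IsIso.hom_inv_id_assoc]
  let ψ : colimit (V.graphFunctor (.necklaces n)) ⟶
      (plethysm (Dih E) ((V.a 0).restrict 2) n).V :=
    colimit.desc (V.graphFunctor (.necklaces n))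
      { pt := _
        ι :=
          { app Γ := δ Γ
            naturality _ _ φ := (hnat φ).trans (Category.comp_id _).symm } }
  have hψ : ∀ Γ, V.graphSumMk (.necklaces n) Γ ≫ ψ = δ Γ := fun Γ => colimit.ι_desc _ _
  have hρ : ∀ τ, V.graphSumAct (.necklaces n) τ ≫ ψ =
      ψ ≫ (plethysm (Dih E) ((V.a 0).restrict 2) n).ρ τ := by
    intro τ
    refine colimit.hom_ext fun Γ => ?_
    obtain ⟨c', hc'⟩ := (c Γ).exists_act V Γ.2.2 (1, τ) (one_mem _)
    refine (Category.assoc _ _ _).symm.trans ?_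
    refine (congrArg (· ≫ ψ) (V.graphSumMk_act (.necklaces n) τ Γ)).trans ((hψ _).trans ?_)
    refine Eq.trans ?_ (Category.assoc _ _ _)
    refine Eq.trans ?_ (congrArg (· ≫ (plethysm (Dih E) ((V.a 0).restrict 2) n).ρ τ) (hψ Γ).symm)
    have hinv : ∀ {X Y Z T : E} (b : X ⟶ Y) (p : Y ⟶ Z) (q : X ⟶ Z) [IsIso p] [IsIso q]
        (r : Y ⟶ T), b ≫ p = q → inv p ≫ r = inv q ≫ b ≫ r := by
      rintro X Y Z T b p q _ _ r rfl
      rw [IsIso.eq_inv_comp, Category.assoc, IsIso.hom_inv_id_assoc]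
    refine (hδ _ _ ((GraphClass.necklaces n).relabelObj τ Γ) c').trans ?_
    refine (@hinv _ _ _ _ _ _ _ (c'.isIso_map V _) ((c Γ).isIso_map V _)
      _ hc').trans ((congrArg (_ ≫ ·) ?_).trans (Category.assoc _ _ _).symm)
    exact (dihClass_ρ _ _ _).symm
  exact ⟨⟨ψ, hρ⟩, fun k f Γ c => (hψ Γ).trans (hδ k f Γ c)⟩

/-- The plethysm of the dihedral module with the module of genus-zero vertices with two marked
legs is the sum over necklaces. -/
theorem exists_plethysm_iso [Preadditive E] [MonoidalPreadditive E] (n : ℕ+) :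
    ∃ Φ : plethysm (Dih E) ((V.a 0).restrict 2) n ≅ V.necklaceModule n,
      ∀ (k : Fin (n + 1)) (f : Surj n k) (Γ : (GraphClass.necklaces n).Objects)
        (c : CyclicGluing f.1 Γ.1), dihClass ((V.a 0).restrict 2) f ≫ Φ.hom.hom =
          c.map V Γ.2.2 ≫ V.graphSumMk (.necklaces n) Γ := by
  obtain ⟨Φ, hΦ⟩ := exists_plethysm_hom V n
  obtain ⟨Ψ, hΨ⟩ := exists_necklace_hom V n
  refine ⟨⟨Φ, Ψ, plethysm_hom_ext _ fun k f => ?_, Action.Hom.ext (colimit.hom_ext fun Γ => ?_)⟩,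
    hΦ⟩
  -- On generators the two composites are `c.map` followed by its inverse and vice versa, one
  -- presentation serving for both maps.
  · obtain ⟨Γ, ⟨c⟩⟩ := exists_necklace n.pos f
    refine (Category.assoc _ _ _).symm.trans ((congrArg (· ≫ Ψ.hom) (hΦ k f Γ c)).trans ?_)
    refine (Category.assoc _ _ _).trans ((congrArg (_ ≫ ·) (hΨ k f Γ c)).trans ?_)
    exact (IsIso.hom_inv_id_assoc _ _).trans (Category.comp_id _).symm
  · obtain ⟨k, f, ⟨c⟩⟩ := exists_cyclicGluing Γ
    refine (Category.assoc _ _ _).symm.trans ((congrArg (· ≫ Φ.hom) (hΨ k f Γ c)).trans ?_)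
    refine (Category.assoc _ _ _).trans ((congrArg (_ ≫ ·) (hΦ k f Γ c)).trans ?_)
    exact (IsIso.inv_hom_id_assoc _ _).trans (Category.comp_id _).symm

end Comparison

end Necklace

theorem mainTheorem8 (𝕜 : Type w) [Field 𝕜] [CharZero 𝕜]
    (E : Type u) [Category.{v} E] [Preadditive E] [Linear 𝕜 E]
    [MonoidalCategory E] [SymmetricCategory E] [MonoidalPreadditive E] [MonoidalLinear 𝕜 E]
    [HasFiniteColimits E] (V : Necklace.StableSModule E) :
    -- the necklaces of genus-zero vertices form a submodule (a direct summand) of `𝐛₁`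
    (∀ n : ℕ+, IsSplitMono (V.necklaceInclusion n)) ∧
    -- which is isomorphic to the plethysm as an `𝕊`-module
    ∃ Φ : (n : ℕ+) → (Necklace.plethysm (Necklace.Dih E) ((V.a 0).restrict 2) n ≅
        V.necklaceModule n),
      -- by gluing vertices with two marked legs in cyclic order
      ∀ (n : ℕ+) (k : Fin (n + 1)) (f : Necklace.Surj n k),
        (∃ Γ : (Necklace.GraphClass.necklaces n).Objects,
          Nonempty (Necklace.CyclicGluing f.1 Γ.1)) ∧
        ∀ (Γ : (Necklace.GraphClass.necklaces n).Objects) (c : Necklace.CyclicGluing f.1 Γ.1),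
          Necklace.dihClass ((V.a 0).restrict 2) f ≫ (Φ n).hom.hom =
            c.map V Γ.2.2 ≫ V.graphSumMk (.necklaces n) Γ := by
  refine ⟨V.isSplitMono_necklaceInclusion, ?_⟩
  choose Φ hΦ using Necklace.exists_plethysm_iso V
  exact ⟨Φ, fun n k f => ⟨Necklace.exists_necklace n.pos f, hΦ n k f⟩⟩
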